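/- Let $p$ be a prime number and $\Gamma$ a topological group isomorphic to $\mathbb{Z}_p$, with a chosen topological generator $\gamma$. Identify the Iwasawa algebra $\Lambda=\mathbb{Z}_p[[\Gamma]]$ with $\mathbb{Z}_p[[T]]$ by $\gamma-1\mapsto T$, so that $\gamma^a$ ($a\in\mathbb{Z}_p$) corresponds to $(1+T)^a=\sum_{n\ge 0}\binom{a}{n}T^n$. Let $M$ be a $\Lambda$-module which is cofinitely generated and cotorsion, i.e. its Pontryagin dual $M^\vee=\mathrm{Hom}_{\mathbb{Z}_p}(M,\mathbb{Q}_p/\mathbb{Z}_p)$ is a finitely generated torsion $\Lambda$-module. Let $\Gamma$ act on $M$ through $\Gamma\to\Lambda^\times$, give $M$ the discrete topology, and assume that the continuous cohomology groups $H^0(\Gamma,M)$ and $H^1(\Gamma,M)$ are finite (the groups $H^i(\Gamma,M)$ with $i\ge 2$ vanish). Set $$\chi(\Gamma,M)=\frac{\#H^0(\Gamma,M)}{\#H^1(\Gamma,M)}.$$ By the structure theorem for finitely generated $\Lambda$-modules there is a $\Lambda$-homomorphism with finite kernel and cokernel $$M^\vee\longrightarrow \Lambda^r\oplus\Big(\bigoplus_{i=1}^s\Lambda/(p^{\mu_i})\Big)\oplus\Big(\bigoplus_{j=1}^t\Lambda/(f_j(T))\Big),$$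 with $\mu_i>0$ and $f_j(T)\in\mathbb{Z}_p[T]$ distinguished polynomials (monic, with all non-leading coefficients divisible by $p$); here $r=0$ as $M^\vee$ is torsion. Put $f_M(T)=p^{\sum_i\mu_i}\prod_j f_j(T)$, $\mu(M)=\sum_i\mu_i$ and $\lambda(M)=\sum_j\deg f_j$ (empty sums being $0$ and empty products $1$); these do not depend on the choice of the homomorphism. Then the following are equivalent: 1. $\chi(\Gamma,M)=1$; 2. $f_M(T)=1$; 3. $\mu(M)=0$ and $\lambda(M)=0$; 4. $M$ has finite cardinality. -/

import Mathlib

noncomputable section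

namespace IwasawaEuler

open PowerSeries

variable (p : ℕ) [Fact p.Prime]

/-- The Iwasawa algebra of `Γ ≅ ℤ_p`, identified with `ℤ_p⟦T⟧` by `γ - 1 ↦ T`, where `γ` is the
chosen topological generator of `Γ`. -/
abbrev Lam : Type := PowerSeries ℤ_[p]

section Action

variable {Γ : Type*} [Group Γ] [TopologicalSpace Γ]

/-- The canonical map from `Γ` to the Iwasawa algebra `ℤ_p⟦T⟧`. The isomorphism `e : ℤ_p ≃ Γ` of
topological groups is the choice of the topological generator `γ = e 1`, so that `γ ^ a = e a`,
and `γ ^ a` is mapped to `(1 + T) ^ a = ∑ n, (a choose n) T ^ n` for `a ∈ ℤ_p`. -/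
def groupElem (e : Multiplicative ℤ_[p] ≃ₜ* Γ) : Γ →* Lam p where
  toFun g := binomialSeries ℤ_[p] (e.symm g).toAdd
  map_one' := by
    rw [map_one, toAdd_one]
    exact binomialSeries_zero
  map_mul' g h := by
    rw [map_mul, toAdd_mul]
    exact binomialSeries_add _ _

/-- The topological generator `γ = e 1` is mapped to `1 + T`. -/
theorem groupElem_generator (e : Multiplicative ℤ_[p] ≃ₜ* Γ) :
    groupElem p e (e (Multiplicative.ofAdd 1)) = 1 + X := by
  have h := binomialSeries_nat (R := ℤ_[p]) (A := ℤ_[p]) 1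
  simpa [groupElem] using h

variable (e : Multiplicative ℤ_[p] ≃ₜ* Γ) (M : Type*) [AddCommGroup M] [Module (Lam p) M]

/-- `H⁰(Γ, M) = M^Γ`, where `Γ` acts on the `Λ`-module `M` through `Γ → Λ`. -/
def H0 : Submodule (Lam p) M where
  carrier := {m | ∀ g : Γ, groupElem p e g • m = m}
  add_mem' {a b} ha hb g := by rw [smul_add, ha g, hb g]
  zero_mem' g := smul_zero _
  smul_mem' c m hm g := by rw [smul_comm, hm g]

/-- Continuous `1`-cocycles (crossed homomorphisms) `c : Γ → M`, with `M` discrete: the maps with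
`c (g h) = c g + g • c h` that are continuous for the discrete topology, i.e. locally constant. -/
def Z1 : Submodule (Lam p) (Γ → M) where
  carrier := {c | IsLocallyConstant c ∧ ∀ g h : Γ, c (g * h) = c g + groupElem p e g • c h}
  add_mem' {a b} ha hb := by
    refine ⟨ha.1.add hb.1, fun g h => ?_⟩
    simp only [Pi.add_apply, ha.2 g h, hb.2 g h, smul_add]
    abel
  zero_mem' := ⟨IsLocallyConstant.const 0, fun g h => by simp⟩
  smul_mem' r c hc := by
    refine ⟨hc.1.comp (fun m => r • m), fun g h => ?_⟩
    simp only [Pi.smul_apply, hc.2 g h, smul_add]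
    rw [smul_comm]

/-- `1`-coboundaries (principal crossed homomorphisms) `g ↦ g • m - m`. -/
def B1 : Submodule (Lam p) (Γ → M) where
  carrier := {c | ∃ m : M, ∀ g : Γ, c g = groupElem p e g • m - m}
  add_mem' := by
    rintro a b ⟨m, hm⟩ ⟨n, hn⟩
    refine ⟨m + n, fun g => ?_⟩
    simp only [Pi.add_apply, hm g, hn g, smul_add]
    abel
  zero_mem' := ⟨0, fun g => by simp⟩
  smul_mem' := by
    rintro r c ⟨m, hm⟩
    refine ⟨r • m, fun g => ?_⟩
    simp only [Pi.smul_apply, hm g, smul_sub]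
    rw [smul_comm]

/-- The continuous cohomology group `H¹(Γ, M)` of the discrete module `M`. -/
abbrev H1 : Type _ := Z1 p e M ⧸ (B1 p e M).comap (Z1 p e M).subtype

/-- The Euler characteristic `χ(Γ, M) = #H⁰(Γ, M) / #H¹(Γ, M)`. -/
def eulerChar : ℚ := (Nat.card (H0 p e M) : ℚ) / (Nat.card (H1 p e M) : ℚ)

end Action

section Dual

/-- The `ℤ_p`-module `ℚ_p / ℤ_p`. -/
abbrev QpModZp : Type := ℚ_[p] ⧸ LinearMap.range (Algebra.linearMap ℤ_[p] ℚ_[p])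

variable (M : Type*) [AddCommGroup M] [Module ℤ_[p] M]

/-- The Pontryagin dual `Hom_{ℤ_p}(M, ℚ_p / ℤ_p)`. -/
def Dual : Type _ := M →ₗ[ℤ_[p]] QpModZp p

instance : AddCommGroup (Dual p M) := inferInstanceAs (AddCommGroup (M →ₗ[ℤ_[p]] QpModZp p))

instance : FunLike (Dual p M) M (QpModZp p) :=
  inferInstanceAs (FunLike (M →ₗ[ℤ_[p]] QpModZp p) M (QpModZp p))

variable [Module (Lam p) M] [IsScalarTower ℤ_[p] (Lam p) M]

/-- The `Λ`-module structure of the Pontryagin dual: `(a • φ) m = φ (a • m)`. -/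
instance : Module (Lam p) (Dual p M) where
  smul a φ := LinearMap.comp (show M →ₗ[ℤ_[p]] QpModZp p from φ) (Algebra.lsmul ℤ_[p] ℤ_[p] M a)
  one_smul φ := DFunLike.ext _ _ fun m => congrArg φ (one_smul (Lam p) m)
  mul_smul a b φ := DFunLike.ext _ _ fun m => congrArg φ (by
    show (a * b) • m = b • a • m
    rw [mul_comm, mul_smul])
  smul_zero a := rfl
  smul_add a φ ψ := rfl
  add_smul a b φ := DFunLike.ext _ _ fun m =>
    (congrArg φ (add_smul a b m)).trans
      (LinearMap.map_add (show M →ₗ[ℤ_[p]] QpModZp p from φ) (a • m) (b • m))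
  zero_smul φ := DFunLike.ext _ _ fun m =>
    (congrArg φ (zero_smul (Lam p) m)).trans
      (LinearMap.map_zero (show M →ₗ[ℤ_[p]] QpModZp p from φ))

theorem dual_smul_apply (a : Lam p) (φ : Dual p M) (m : M) : (a • φ) m = φ (a • m) := rfl

/-- `M` is cofinitely generated over `Λ`. -/
def CofinitelyGenerated : Prop := Module.Finite (Lam p) (Dual p M)

/-- `M` is cotorsion over `Λ`. -/
def Cotorsion : Prop := Module.IsTorsion (Lam p) (Dual p M)

end Dual

section Invariants

/-- The parameters of an elementary `Λ`-module
`Λ^r ⊕ (⊕_i Λ/(p^{μ_i})) ⊕ (⊕_j Λ/(f_j))` with `μ_i > 0` and `f_j` distinguished polynomials. -/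
structure Elementary where
  /-- the rank of the free part -/
  r : ℕ
  /-- the number of summands `Λ/(p^{μ_i})` -/
  s : ℕ
  /-- the number of summands `Λ/(f_j)` -/
  t : ℕ
  /-- the exponents `μ_i` -/
  mu : Fin s → ℕ
  mu_pos : ∀ i, 0 < mu i
  /-- the distinguished polynomials `f_j` -/
  f : Fin t → Polynomial ℤ_[p]
  distinguished : ∀ j, (f j).IsDistinguishedAt (Ideal.span {(p : ℤ_[p])})

instance : Nonempty (Elementary p) :=
  ⟨⟨0, 0, 0, Fin.elim0, fun i => i.elim0, Fin.elim0, fun j => j.elim0⟩⟩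

variable {p}

/-- The elementary module `Λ^r ⊕ (⊕_i Λ/(p^{μ_i})) ⊕ (⊕_j Λ/(f_j))`. -/
abbrev Elementary.toModule (D : Elementary p) : Type :=
  (Fin D.r → Lam p) ×
    ((i : Fin D.s) → Lam p ⧸ Ideal.span {(p : Lam p) ^ D.mu i}) ×
    ((j : Fin D.t) → Lam p ⧸ Ideal.span {(D.f j : Lam p)})

/-- A pseudo-isomorphism is a `Λ`-linear map with finite kernel and finite cokernel. -/
def IsPseudoIso {N N' : Type*} [AddCommGroup N] [AddCommGroup N'] [Module (Lam p) N]
    [Module (Lam p) N'] (φ : N →ₗ[Lam p] N') : Prop :=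
  Finite (LinearMap.ker φ) ∧ Finite (N' ⧸ LinearMap.range φ)

variable (p)
variable (M : Type*) [AddCommGroup M] [Module ℤ_[p] M] [Module (Lam p) M]
  [IsScalarTower ℤ_[p] (Lam p) M]

/-- Parameters of an elementary module to which the Pontryagin dual of `M` admits a
pseudo-isomorphism. Such parameters exist whenever `M` is cofinitely generated, by the structure
theorem for finitely generated `Λ`-modules; the numbers and the polynomial read off from them below
do not depend on the choice. -/
def elementary : Elementary p :=
  Classical.epsilon fun D : Elementary p =>
    ∃ φ : Dual p M →ₗ[Lam p] D.toModule, IsPseudoIso φ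

/-- The characteristic element `f_M(T) = p ^ (∑ μ_i) * ∏ f_j(T)`. -/
def charElement : Polynomial ℤ_[p] :=
  (p : Polynomial ℤ_[p]) ^ (∑ i, (elementary p M).mu i) * ∏ j, (elementary p M).f j

/-- The `μ`-invariant `∑ μ_i`. -/
def muInvariant : ℕ := ∑ i, (elementary p M).mu i

/-- The `λ`-invariant `∑ deg f_j`. -/
def lambdaInvariant : ℕ := ∑ j, ((elementary p M).f j).natDegree

end Invariants

end IwasawaEuler

end

noncomputable section

namespace IwasawaEuler

open PowerSeries

/-! Write `N` for the Pontryagin dual of `M`. Since `(1 + T)^a - 1` is a multiple of `T`, `H⁰(Γ, M)`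
is the kernel of `T` on `M`; evaluating cocycles at `γ` identifies `H¹(Γ, M)` with `M / TM`. Duality
turns these into `N / TN` and the kernel of `T` on `N`, so `χ` is the Herbrand quotient `#(N / TN) /
#N[T]`.

Let `φ : N → E` be a pseudo-isomorphism to an elementary module. Finiteness of `N / TN` makes `E /
TE` finite, which forces `f_j(0) ≠ 0` for all `j`, so `T` is injective on `E`. The Herbrand quotient
does not see the finite kernel and cokernel of `φ`, whence `χ = #(E / TE)`. If `χ = 1`, then `E =
TE`, so `E = 0` by Nakayama, and `N` and `M` are finite. Conversely, an endomorphism of a finite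
group has kernel and cokernel of the same order.

Finiteness of `M` amounts to finiteness of `E`. No nonzero elementary module is finite, and since
`N` is torsion the free part vanishes; so this says that both invariants vanish, or that the
characteristic element is `1`.

The parameters of `E` are chosen by `Classical.epsilon`, so the existence half of the structure
theorem is needed for them to carry a pseudo-isomorphism; uniqueness is not. A torsion module is
split, up to finite modules, along the coprime prime powers of an annihilator. For a power of one
prime `π`, localising at `(π)` gives a principal ideal domain, and the decomposition there descends
up to elements prime to `π`. The errors are finite because `Λ / (a, b)` is finite for relatively
prime `a`, `b`. -/

theorem finite_of_forall_exists_finite_quotient {R K : Type*} [CommRing R] [AddCommGroup K]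
    [Module R K] [Module.Finite R K]
    (h : ∀ x : K, ∃ I : Ideal R, Finite (R ⧸ I) ∧ ∀ r ∈ I, r • x = 0) : Finite K := by
  have key : Finite (⊤ : Submodule R K) := by
    refine Submodule.fg_induction (motive := fun N _ => Finite N) ?_ ?_ ⊤ Module.Finite.fg_top
    · intro x
      obtain ⟨I, hI, hx⟩ := h x
      let f : (R ⧸ I) →ₗ[R] K := Submodule.liftQ I (LinearMap.toSpanSingleton R K x)
        fun r hr => hx r hr
      have hr : LinearMap.range f = Submodule.span R {x} := by
        exact (Submodule.range_liftQ _ _ _).trans (LinearMap.range_toSpanSingleton ..)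
      rw [← hr]
      exact Finite.of_surjective f.rangeRestrict f.surjective_rangeRestrict
    · intro N₁ N₂ _ _ h₁ h₂
      have := h₁
      have := h₂
      refine Finite.of_surjective (fun x : N₁ × N₂ =>
        (⟨x.1 + x.2, Submodule.add_mem_sup x.1.2 x.2.2⟩ :
        (N₁ ⊔ N₂ : Submodule R K))) ?_
      rintro ⟨y, hy⟩
      obtain ⟨a, ha, b, hb, rfl⟩ := Submodule.mem_sup.1 hy
      exact ⟨(⟨a, ha⟩, ⟨b, hb⟩), rfl⟩
  exact Finite.of_equiv _ (Submodule.topEquiv (R := R) (M := K)).toEquiv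

/-! ### Finite quotients of the Iwasawa algebra -/

section Padic

variable (p : ℕ) [Fact p.Prime]

theorem finite_padicInt_quotient (n : ℕ) : Finite (ℤ_[p] ⧸ Ideal.span {(p : ℤ_[p]) ^ n}) := by
  have : NeZero (p ^ n) := ⟨pow_ne_zero _ (Fact.out : p.Prime).ne_zero⟩
  rw [← PadicInt.ker_toZModPow n]
  exact Finite.of_injective _ (RingHom.kerLift_injective (PadicInt.toZModPow (p := p) n))

theorem exists_associated_pow_of_ne_zero {c : ℤ_[p]} (hc : c ≠ 0) :
    ∃ n : ℕ, Associated c ((p : ℤ_[p]) ^ n) :=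
  (IsDiscreteValuationRing.associated_pow_irreducible hc (PadicInt.irreducible_p))

theorem finite_padicInt_quotient_of_ne_zero {c : ℤ_[p]} (hc : c ≠ 0) :
    Finite (ℤ_[p] ⧸ Ideal.span {c}) := by
  obtain ⟨n, hn⟩ := exists_associated_pow_of_ne_zero p hc
  rw [Ideal.span_singleton_eq_span_singleton.2 hn]
  exact finite_padicInt_quotient p n

variable {p}

theorem map_residue_eq_zero_iff {a : Lam p} :
    a.map (IsLocalRing.residue ℤ_[p]) = 0 ↔ (p : Lam p) ∣ a := by
  have hC : (p : Lam p) = C (p : ℤ_[p]) := by simp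
  constructor
  · intro h
    have h' : ∀ n, ∃ d, coeff n a = (p : ℤ_[p]) * d := by
      intro n
      have h1 := congrArg (coeff n) h
      rw [coeff_map, map_zero, IsLocalRing.residue_eq_zero_iff, PadicInt.maximalIdeal_eq_span_p,
        Ideal.mem_span_singleton] at h1
      exact h1
    choose d hd using h'
    refine ⟨PowerSeries.mk d, ?_⟩
    ext n
    rw [hC, coeff_C_mul, coeff_mk, hd]
  · rintro ⟨b, rfl⟩
    have : IsLocalRing.residue ℤ_[p] (p : ℤ_[p]) = 0 := by
      rw [IsLocalRing.residue_eq_zero_iff, PadicInt.maximalIdeal_eq_span_p]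
      exact Ideal.mem_span_singleton_self _
    rw [hC, map_mul, map_C, this, map_zero, zero_mul]

variable (p) in
theorem prime_natCast_lam : Prime (p : Lam p) := by
  refine ⟨?_, ?_, ?_⟩
  · have hC : (p : Lam p) = C (p : ℤ_[p]) := by simp
    rw [hC, Ne, map_eq_zero_iff C C_injective]
    exact_mod_cast (Fact.out : p.Prime).ne_zero
  · intro h
    have h1 := map_residue_eq_zero_iff.2 (dvd_refl (p : Lam p))
    have h2 := h.map (PowerSeries.map (IsLocalRing.residue ℤ_[p]))
    rw [h1] at h2
    exact not_isUnit_zero h2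
  · intro a b h
    rw [← map_residue_eq_zero_iff, map_mul, mul_eq_zero] at h
    simpa only [map_residue_eq_zero_iff] using h

/-- Weierstrass preparation. -/
theorem exists_distinguished_of_not_dvd {a : Lam p} (ha : ¬ (p : Lam p) ∣ a) :
    ∃ F : Polynomial ℤ_[p], F.IsDistinguishedAt (Ideal.span {(p : ℤ_[p])}) ∧
      Ideal.span {a} = Ideal.span {(F : Lam p)} := by
  obtain ⟨F, u, h⟩ := exists_isWeierstrassFactorization (g := a)
    (fun h => ha (map_residue_eq_zero_iff.1 h))
  refine ⟨F, ?_, ?_⟩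
  · rw [← PadicInt.maximalIdeal_eq_span_p]
    exact h.isDistinguishedAt
  · rw [h.eq_mul, Ideal.span_singleton_mul_right_unit h.isUnit]

/-- By Weierstrass, `a` is a unit times a monic polynomial `F`, and `Λ / (a) ≅ ℤ_p[T] / (F)`. -/
theorem moduleFinite_quotient_of_not_dvd {a : Lam p} (ha : ¬ (p : Lam p) ∣ a) :
    Module.Finite ℤ_[p] (Lam p ⧸ Ideal.span {a}) := by
  obtain ⟨F, u, h⟩ := exists_isWeierstrassFactorization (g := a)
    (fun h => ha (map_residue_eq_zero_iff.1 h))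
  have := h.isDistinguishedAt.monic.finite_quotient
  exact Module.Finite.equiv h.algEquivQuotient.toLinearEquiv

theorem mk_mem_nonZeroDivisors_of_isRelPrime {a b : Lam p} (h : IsRelPrime a b) :
    Ideal.Quotient.mk (Ideal.span {a}) b ∈ nonZeroDivisors (Lam p ⧸ Ideal.span {a}) := by
  rw [mem_nonZeroDivisors_iff_right]
  intro x hx
  obtain ⟨x, rfl⟩ := Ideal.Quotient.mk_surjective x
  rw [← map_mul, Ideal.Quotient.eq_zero_iff_mem, Ideal.mem_span_singleton] at hx
  rw [Ideal.Quotient.eq_zero_iff_mem, Ideal.mem_span_singleton]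
  exact h.dvd_of_dvd_mul_right hx

/-- `Λ / (a)` is finite over `ℤ_p`, so the class of `b` is algebraic; being a nonzerodivisor, it
divides a nonzero constant `c`. Hence `Λ / (a, b)` is a finitely generated `ℤ_p`-module killed by
`c`. -/
theorem finite_quotient_of_isRelPrime_of_not_dvd {a b : Lam p} (h : IsRelPrime a b)
    (ha : ¬ (p : Lam p) ∣ a) : Finite (Lam p ⧸ Ideal.span {a, b}) := by
  have := moduleFinite_quotient_of_not_dvd ha
  set B := Lam p ⧸ Ideal.span {a}
  let bb : B := Ideal.Quotient.mk (Ideal.span {a}) b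
  have hb : IsAlgebraic ℤ_[p] bb := (IsIntegral.of_finite ℤ_[p] bb).isAlgebraic
  obtain ⟨c, hc0, hc⟩ := hb.exists_nonzero_dvd (mk_mem_nonZeroDivisors_of_isRelPrime h)
  have hle : Ideal.span {a} ≤ Ideal.span {a, b} := Ideal.span_mono (by simp)
  let π : B →ₐ[ℤ_[p]] (Lam p ⧸ Ideal.span {a, b}) := Ideal.Quotient.factorₐ ℤ_[p] hle
  have hπ : Function.Surjective π := Ideal.Quotient.factor_surjective hle
  have : Module.Finite ℤ_[p] (Lam p ⧸ Ideal.span {a, b}) :=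
    Module.Finite.of_surjective π.toLinearMap hπ
  have hbb : π bb = 0 := by
    change Ideal.Quotient.mk (Ideal.span {a, b}) b = 0
    exact Ideal.Quotient.eq_zero_iff_mem.2 (Ideal.subset_span (by simp))
  have hc' : algebraMap ℤ_[p] (Lam p ⧸ Ideal.span {a, b}) c = 0 := by
    obtain ⟨d, hd⟩ := hc
    rw [← π.commutes, hd, map_mul, hbb, zero_mul]
  refine finite_of_forall_exists_finite_quotient (R := ℤ_[p]) fun x =>
    ⟨Ideal.span {c}, finite_padicInt_quotient_of_ne_zero p hc0, fun r hr => ?_⟩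
  obtain ⟨d, rfl⟩ := Ideal.mem_span_singleton.1 hr
  exact (Algebra.smul_def (c * d) x).trans (by rw [map_mul, hc', zero_mul, zero_mul])

/-- The quotient of the Iwasawa algebra by two relatively prime elements is finite. -/
theorem finite_quotient_of_isRelPrime {a b : Lam p} (h : IsRelPrime a b) :
    Finite (Lam p ⧸ Ideal.span {a, b}) := by
  by_cases ha : (p : Lam p) ∣ a
  · rw [Set.pair_comm]
    exact finite_quotient_of_isRelPrime_of_not_dvd h.symm
      fun hb => (prime_natCast_lam p).not_isUnit (h ha hb)
  · exact finite_quotient_of_isRelPrime_of_not_dvd h ha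

/-- Each cyclic submodule is a quotient of some finite `Λ / (a, b)`. The element `b` may depend on
`x`, which is the form in which localisation supplies it. -/
theorem finite_of_smul_eq_zero_of_isRelPrime {K : Type*} [AddCommGroup K] [Module (Lam p) K]
    [Module.Finite (Lam p) K] (a : Lam p) (ha : ∀ x : K, a • x = 0)
    (h : ∀ x : K, ∃ b : Lam p, IsRelPrime a b ∧ b • x = 0) : Finite K := by
  refine finite_of_forall_exists_finite_quotient (R := Lam p) fun x => ?_
  obtain ⟨b, hab, hb⟩ := h x
  refine ⟨Ideal.span {a, b}, finite_quotient_of_isRelPrime hab, fun r hr => ?_⟩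
  obtain ⟨c, d, rfl⟩ := Ideal.mem_span_pair.1 hr
  rw [add_smul, mul_smul, mul_smul, ha, hb, smul_zero, smul_zero, add_zero]

end Padic

/-! ### Localisation at a principal prime -/

/-- Clearing denominators: as `N` is finitely presented, some multiple `s • ψ` descends to `h : N →
E`. It becomes an isomorphism after localisation, so its kernel and cokernel are `S`-torsion. -/
theorem exists_linearMap_of_isLocalizedModule {R N E N' E' : Type*} [CommRing R] (S : Submonoid R)
    [AddCommGroup N] [AddCommGroup E] [AddCommGroup N'] [AddCommGroup E'] [Module R N] [Module R E]
    [Module R N'] [Module R E'] [Module.FinitePresentation R N] (i : N →ₗ[R] N') (j : E →ₗ[R] E')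
    [IsLocalizedModule S i] [IsLocalizedModule S j] (ψ : N' ≃ₗ[R] E') :
    ∃ h : N →ₗ[R] E, (∀ x, h x = 0 → ∃ s ∈ S, s • x = 0) ∧
      ∀ y, ∃ s ∈ S, s • y ∈ LinearMap.range h := by
  obtain ⟨h, s, hs⟩ := Module.FinitePresentation.exists_lift_of_isLocalizedModule S j
    (ψ.toLinearMap ∘ₗ i)
  have hs' : ∀ x, j (h x) = (s : R) • ψ (i x) := fun x => by
    exact LinearMap.congr_fun hs x
  refine ⟨h, fun x hx => ?_, fun y => ?_⟩
  · have h1 : i ((s : R) • x) = i 0 := by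
      apply ψ.injective
      rw [map_smul, map_smul, ← hs', hx, map_zero, map_zero, map_zero]
    obtain ⟨c, hc⟩ := (IsLocalizedModule.eq_iff_exists S i).1 h1
    refine ⟨c * s, S.mul_mem c.2 s.2, ?_⟩
    rw [smul_zero] at hc
    rw [mul_smul]
    exact hc
  · obtain ⟨⟨x, t⟩, hx⟩ := IsLocalizedModule.surj S i (ψ.symm (j y))
    have h1 : j (((s : R) * (t : R)) • y) = j (h x) := by
      have h2 : ψ (i x) = (t : R) • j y := by
        rw [← hx]
        change ψ ((t : R) • ψ.symm (j y)) = _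
        rw [map_smul, LinearEquiv.apply_symm_apply]
      rw [map_smul, hs', h2, mul_smul]
    obtain ⟨c, hc⟩ := (IsLocalizedModule.eq_iff_exists S j).1 h1
    refine ⟨c * (s * t), S.mul_mem c.2 (S.mul_mem s.2 t.2), ?_⟩
    refine ⟨(c : R) • x, ?_⟩
    rw [map_smul, mul_smul]
    exact hc.symm

theorem exists_isLocalizedModule_quotient_span {R R' : Type*} [CommRing R] [CommRing R']
    [Algebra R R'] (S : Submonoid R) [IsLocalization S R'] (a : R) :
    ∃ j : (R ⧸ Ideal.span {a}) →ₗ[R] (R' ⧸ Ideal.span {algebraMap R R' a}),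
      IsLocalizedModule S j := by
  have h : Submodule.localized' R' S (Algebra.linearMap R R') (Ideal.span {a}) =
      Ideal.span {algebraMap R R' a} := by
    rw [Ideal.span, Submodule.localized'_span, Set.image_singleton]
    rfl
  let e := (Submodule.quotEquivOfEq _ _ h).restrictScalars R
  exact ⟨e.toLinearMap ∘ₗ Submodule.toLocalizedQuotient' R' S (Algebra.linearMap R R')
    (Ideal.span {a}), IsLocalizedModule.of_linearEquiv S _ e⟩

section

variable {R : Type*} [CommRing R] {π : R}

theorem maximalIdeal_localization_atPrime_span (P : Ideal R) [P.IsPrime]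
    (hP : P = Ideal.span {π}) :
    IsLocalRing.maximalIdeal (Localization.AtPrime P) =
      Ideal.span {algebraMap R (Localization.AtPrime P) π} :=
  Localization.AtPrime.map_eq_maximalIdeal.symm.trans
    ((congrArg (Ideal.map (algebraMap R (Localization.AtPrime P))) hP).trans
      (by rw [Ideal.map_span, Set.image_singleton]))

/-- A Noetherian local domain with principal maximal ideal is a principal ideal ring. -/
theorem isPrincipalIdealRing_localization_atPrime_span [IsDomain R] [IsNoetherianRing R]
    (P : Ideal R) [P.IsPrime]
    (hP : P = Ideal.span {π}) :
    IsPrincipalIdealRing (Localization.AtPrime P) := by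
  apply ((tfae_of_isNoetherianRing_of_isLocalRing_of_isDomain (Localization.AtPrime P)).out 0 4).2
  exact ⟨algebraMap R _ π, maximalIdeal_localization_atPrime_span P hP⟩

theorem associated_of_irreducible_localization_atPrime_span (P : Ideal R) [P.IsPrime]
    (hP : P = Ideal.span {π}) {q : Localization.AtPrime P} (hq : Irreducible q) :
    Associated q (algebraMap R (Localization.AtPrime P) π) := by
  have h1 : q ∈ IsLocalRing.maximalIdeal (Localization.AtPrime P) := hq.not_isUnit
  have h2 := maximalIdeal_localization_atPrime_span P hP
  have h3 : algebraMap R (Localization.AtPrime P) π ∈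
      IsLocalRing.maximalIdeal (Localization.AtPrime P) := by
    rw [h2]
    exact Ideal.mem_span_singleton_self _
  rw [h2, Ideal.mem_span_singleton] at h1
  obtain ⟨c, hc⟩ := h1
  have hu := (hq.isUnit_or_isUnit hc).resolve_left h3
  rw [hc]
  exact (associated_mul_unit_left _ _ hu)

/-- Over the localisation at `(π)` the structure theorem over a principal ideal domain applies, and
every irreducible is associated to `π`. The summands are therefore localisations of `R / (π ^ d)`,
and the isomorphism descends. -/
theorem exists_linearMap_prime_pow [IsDomain R] [IsNoetherianRing R] {N : Type*}
    [AddCommGroup N] [Module R N] [Module.Finite R N]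
    (hπ : Prime π) (n : ℕ) (hN : ∀ x : N, π ^ n • x = 0) :
    ∃ (k : ℕ) (d : Fin k → ℕ) (h : N →ₗ[R] ((i : Fin k) → R ⧸ Ideal.span {π ^ d i})),
      (∀ x, h x = 0 → ∃ s, ¬ π ∣ s ∧ s • x = 0) ∧
      ∀ y : (i : Fin k) → R ⧸ Ideal.span {π ^ d i}, ∃ s, ¬ π ∣ s ∧ s • y ∈ LinearMap.range h := by
  have hP : (Ideal.span {π}).IsPrime := (Ideal.span_singleton_prime hπ.ne_zero).2 hπ
  generalize hPdef : Ideal.span {π} = P at hP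
  have hmem : ∀ s, s ∈ P.primeCompl ↔ ¬ π ∣ s := fun s => by
    rw [← Ideal.mem_span_singleton, hPdef]
    rfl
  have := isPrincipalIdealRing_localization_atPrime_span P hPdef.symm
  have hinj : Function.Injective (algebraMap R (Localization.AtPrime P)) :=
    IsLocalization.injective _ P.primeCompl_le_nonZeroDivisors
  have htors : Module.IsTorsion (Localization.AtPrime P) (LocalizedModule P.primeCompl N) := by
    intro x
    refine ⟨⟨algebraMap R (Localization.AtPrime P) (π ^ n), mem_nonZeroDivisors_of_ne_zero ?_⟩, ?_⟩
    · rw [Ne, map_eq_zero_iff _ hinj]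
      exact pow_ne_zero _ hπ.ne_zero
    · change (algebraMap R (Localization.AtPrime P) (π ^ n)) • x = 0
      rw [algebraMap_smul]
      induction x using LocalizedModule.induction_on with
      | h m s => rw [LocalizedModule.smul'_mk, hN, LocalizedModule.zero_mk]
  obtain ⟨ι, _, q, hq, e, ⟨ψ⟩⟩ := Module.equiv_directSum_of_isTorsion htors
  classical
  let ε := (Fintype.equivFin ι).symm
  let d : Fin (Fintype.card ι) → ℕ := fun i => e (ε i)
  choose j hj using fun i => exists_isLocalizedModule_quotient_span
    (R' := Localization.AtPrime P) P.primeCompl (π ^ d i)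
  have hspan : ∀ i, Ideal.span {q (ε i) ^ e (ε i)} =
      Ideal.span {algebraMap R (Localization.AtPrime P) (π ^ d i)} := by
    intro i
    rw [Ideal.span_singleton_eq_span_singleton, map_pow]
    exact (associated_of_irreducible_localization_atPrime_span P hPdef.symm (hq _)).pow_pow
  let ψ₁ := (ψ.trans (DirectSum.linearEquivFunOnFintype _ ι _)).trans
    ((LinearEquiv.piCongrLeft' (Localization.AtPrime P) _ ε.symm).trans
      (LinearEquiv.piCongrRight fun i => Submodule.quotEquivOfEq _ _ (hspan i)))
  have := Module.finitePresentation_of_finite R N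
  obtain ⟨h, h1, h2⟩ := exists_linearMap_of_isLocalizedModule P.primeCompl
    (LocalizedModule.mkLinearMap P.primeCompl N) (LinearMap.pi fun i => j i ∘ₗ LinearMap.proj i)
    (ψ₁.restrictScalars R)
  refine ⟨_, d, h, fun x hx => ?_, fun y => ?_⟩
  · obtain ⟨s, hs, hsx⟩ := h1 x hx
    exact ⟨s, (hmem s).1 hs, hsx⟩
  · obtain ⟨s, hs, hsx⟩ := h2 y
    exact ⟨s, (hmem s).1 hs, hsx⟩

end

theorem finite_of_finite_ker {R A B : Type*} [Ring R] [AddCommGroup A] [AddCommGroup B] [Module R A]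
    [Module R B] (f : A →ₗ[R] B) (hk : Finite (LinearMap.ker f))
    (hr : Finite (LinearMap.range f)) : Finite A := by
  have : Finite (A ⧸ LinearMap.ker f) := Finite.of_equiv _ f.quotKerEquivRange.symm.toEquiv
  apply Nat.finite_of_card_ne_zero
  rw [Submodule.card_eq_card_quotient_mul_card (LinearMap.ker f)]
  exact mul_ne_zero Nat.card_pos.ne' Nat.card_pos.ne'

/-! ### Pseudo-isomorphisms -/

section PseudoIso

variable {p : ℕ} [Fact p.Prime] {N₁ N₂ N₃ N₄ : Type*} [AddCommGroup N₁] [AddCommGroup N₂]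
  [AddCommGroup N₃] [AddCommGroup N₄] [Module (Lam p) N₁] [Module (Lam p) N₂] [Module (Lam p) N₃]
  [Module (Lam p) N₄]

theorem IsPseudoIso.comp {ψ : N₂ →ₗ[Lam p] N₃} {φ : N₁ →ₗ[Lam p] N₂} (hψ : IsPseudoIso ψ)
    (hφ : IsPseudoIso φ) : IsPseudoIso (ψ ∘ₗ φ) := by
  have := hψ.1
  have := hψ.2
  have := hφ.1
  have := hφ.2
  constructor
  · let f : LinearMap.ker (ψ ∘ₗ φ) →ₗ[Lam p] LinearMap.ker ψ :=
      φ.restrict fun x hx => by simpa using hx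
    refine finite_of_finite_ker f ?_ inferInstance
    refine Finite.of_injective (β := LinearMap.ker φ)
      (fun x => ⟨x.1.1, congrArg Subtype.val (LinearMap.mem_ker.1 x.2)⟩) ?_
    intro x y h
    exact Subtype.ext (Subtype.ext (Subtype.mk.inj h))
  · let f : (N₂ ⧸ LinearMap.range φ) →ₗ[Lam p] (N₃ ⧸ LinearMap.range (ψ ∘ₗ φ)) :=
      Submodule.mapQ _ _ ψ (by
        rintro _ ⟨x, rfl⟩
        exact ⟨x, rfl⟩)
    refine Finite.of_surjective (fun x : (N₃ ⧸ LinearMap.range ψ) × (N₂ ⧸ LinearMap.range φ) =>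
      Submodule.Quotient.mk (Quotient.out x.1) + f x.2) ?_
    intro y
    obtain ⟨y, rfl⟩ := Submodule.Quotient.mk_surjective _ y
    have h1 : (Submodule.Quotient.mk (Quotient.out (Submodule.Quotient.mk y :
        N₃ ⧸ LinearMap.range ψ)) : N₃ ⧸ LinearMap.range ψ) = Submodule.Quotient.mk y :=
      Quotient.out_eq _
    obtain ⟨z, hz⟩ := (Submodule.Quotient.eq _).1 h1.symm
    refine ⟨(Submodule.Quotient.mk y, Submodule.Quotient.mk z), ?_⟩
    change Submodule.Quotient.mk _ + Submodule.Quotient.mk (ψ z) = Submodule.Quotient.mk y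
    rw [hz, ← Submodule.Quotient.mk_add, add_sub_cancel]

theorem isPseudoIso_of_linearEquiv (e : N₁ ≃ₗ[Lam p] N₂) : IsPseudoIso e.toLinearMap := by
  constructor
  · rw [LinearEquiv.ker]
    infer_instance
  · rw [LinearEquiv.range]
    exact Finite.of_subsingleton

theorem IsPseudoIso.prodMap {φ : N₁ →ₗ[Lam p] N₂} {ψ : N₃ →ₗ[Lam p] N₄} (hφ : IsPseudoIso φ)
    (hψ : IsPseudoIso ψ) : IsPseudoIso (φ.prodMap ψ) := by
  have := hψ.1
  have := hψ.2
  have := hφ.1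
  have := hφ.2
  constructor
  · refine Finite.of_injective (β := LinearMap.ker φ × LinearMap.ker ψ)
      (fun x => (⟨x.1.1, congrArg Prod.fst (LinearMap.mem_ker.1 x.2)⟩,
        ⟨x.1.2, congrArg Prod.snd (LinearMap.mem_ker.1 x.2)⟩)) ?_
    intro x y h
    rw [Prod.ext_iff, Subtype.ext_iff, Subtype.ext_iff] at h
    exact Subtype.ext (Prod.ext h.1 h.2)
  · let f : (N₂ ⧸ LinearMap.range φ) →ₗ[Lam p] ((N₂ × N₄) ⧸ LinearMap.range (φ.prodMap ψ)) :=
      Submodule.mapQ _ _ (LinearMap.inl _ _ _) (by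
        rintro _ ⟨x, rfl⟩
        exact ⟨(x, 0), by simp⟩)
    let g : (N₄ ⧸ LinearMap.range ψ) →ₗ[Lam p] ((N₂ × N₄) ⧸ LinearMap.range (φ.prodMap ψ)) :=
      Submodule.mapQ _ _ (LinearMap.inr _ _ _) (by
        rintro _ ⟨x, rfl⟩
        exact ⟨(0, x), by simp⟩)
    refine Finite.of_surjective (fun x : (N₂ ⧸ LinearMap.range φ) × (N₄ ⧸ LinearMap.range ψ) =>
      f x.1 + g x.2) ?_
    intro y
    obtain ⟨⟨y, z⟩, rfl⟩ := Submodule.Quotient.mk_surjective _ y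
    refine ⟨(Submodule.Quotient.mk y, Submodule.Quotient.mk z), ?_⟩
    change Submodule.Quotient.mk (y, 0) + Submodule.Quotient.mk (0, z) = _
    rw [← Submodule.Quotient.mk_add, Prod.mk_add_mk, add_zero, zero_add]

/-- Kernel and cokernel are finitely generated and killed by `a`, and each of their elements is also
killed by something prime to `a`. -/
theorem isPseudoIso_of_isRelPrime [Module.Finite (Lam p) N₁] [Module.Finite (Lam p) N₂]
    {φ : N₁ →ₗ[Lam p] N₂} {a : Lam p} (h₁ : ∀ x : N₁, a • x = 0) (h₂ : ∀ x : N₂, a • x = 0)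
    (hker : ∀ x, φ x = 0 → ∃ s, IsRelPrime a s ∧ s • x = 0)
    (hrange : ∀ y, ∃ s, IsRelPrime a s ∧ s • y ∈ LinearMap.range φ) : IsPseudoIso φ := by
  constructor
  · refine finite_of_smul_eq_zero_of_isRelPrime a (fun x => Subtype.ext (h₁ x)) fun x => ?_
    obtain ⟨s, hs, hsx⟩ := hker x x.2
    exact ⟨s, hs, Subtype.ext hsx⟩
  · refine finite_of_smul_eq_zero_of_isRelPrime a (fun x => ?_) fun x => ?_
    · obtain ⟨x, rfl⟩ := Submodule.Quotient.mk_surjective _ x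
      rw [← Submodule.Quotient.mk_smul, h₂, Submodule.Quotient.mk_zero]
    · obtain ⟨x, rfl⟩ := Submodule.Quotient.mk_surjective _ x
      obtain ⟨s, hs, hsx⟩ := hrange x
      refine ⟨s, hs, ?_⟩
      rw [← Submodule.Quotient.mk_smul, Submodule.Quotient.mk_eq_zero]
      exact hsx

end PseudoIso

/-! ### The structure theorem for torsion modules -/

section Structure

variable {p : ℕ} [Fact p.Prime]

theorem exists_isPseudoIso_of_prime_pow {N : Type*} [AddCommGroup N] [Module (Lam p) N]
    [Module.Finite (Lam p) N] {π : Lam p} (hπ : Prime π) (n : ℕ) (hN : ∀ x : N, π ^ n • x = 0) :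
    ∃ (k : ℕ) (d : Fin k → ℕ)
      (φ : N →ₗ[Lam p] ((i : Fin k) → Lam p ⧸ Ideal.span {π ^ d i})), IsPseudoIso φ := by
  obtain ⟨k, d, φ, h1, h2⟩ := exists_linearMap_prime_pow hπ n hN
  have hrel : ∀ m s, ¬ π ∣ s → IsRelPrime (π ^ m) s := fun m s hs =>
    ((hπ.irreducible.isRelPrime_iff_not_dvd).2 hs).pow_left
  -- The exponent is large enough for one power of `π` to kill both source and target.
  refine ⟨k, d, φ, isPseudoIso_of_isRelPrime (a := π ^ (n + ∑ i, d i)) (fun x => ?_) (fun x => ?_)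
    (fun x hx => ?_) fun y => ?_⟩
  · rw [pow_add, mul_comm, mul_smul, hN, smul_zero]
  · ext i
    obtain ⟨y, hy⟩ := Ideal.Quotient.mk_surjective (x i)
    rw [Pi.smul_apply, ← hy]
    change Ideal.Quotient.mk _ (π ^ (n + ∑ i, d i) * y) = 0
    rw [Ideal.Quotient.eq_zero_iff_mem, Ideal.mem_span_singleton]
    refine Dvd.dvd.mul_right (pow_dvd_pow _ ?_) _
    exact (Finset.single_le_sum (fun _ _ => Nat.zero_le _) (Finset.mem_univ i)).trans
      (Nat.le_add_left _ _)
  · obtain ⟨s, hs, hsx⟩ := h1 x hx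
    exact ⟨s, hrel _ _ hs, hsx⟩
  · obtain ⟨s, hs, hsx⟩ := h2 y
    exact ⟨s, hrel _ _ hs, hsx⟩

/-- The kernel `aN ∩ bN` is killed by `a` and by `b`, since `abN = 0`. So is the cokernel, which is
`N / (aN + bN)` through `(x, y) ↦ x - y`. -/
theorem isPseudoIso_prod_quotient {N : Type*} [AddCommGroup N] [Module (Lam p) N]
    [Module.Finite (Lam p) N] {a b : Lam p} (hab : IsRelPrime a b)
    (hN : ∀ x : N, (a * b) • x = 0) :
    IsPseudoIso ((Submodule.mkQ (LinearMap.range (LinearMap.lsmul (Lam p) N a))).prod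
      (Submodule.mkQ (LinearMap.range (LinearMap.lsmul (Lam p) N b)))) := by
  constructor
  · refine finite_of_smul_eq_zero_of_isRelPrime a (fun x => ?_) fun x => ⟨b, hab, ?_⟩
    · have h := congrArg Prod.snd (LinearMap.mem_ker.1 x.2)
      obtain ⟨y, hy⟩ := (Submodule.Quotient.mk_eq_zero _).1 h
      apply Subtype.ext
      change a • x.1 = 0
      rw [← hy, ← hN y, mul_smul]
      rfl
    · have h := congrArg Prod.fst (LinearMap.mem_ker.1 x.2)
      obtain ⟨y, hy⟩ := (Submodule.Quotient.mk_eq_zero _).1 h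
      apply Subtype.ext
      change b • x.1 = 0
      rw [← hy, ← hN y, mul_comm, mul_smul]
      rfl
  · have key : ∀ (x y : N), (∃ u v, x - y = a • u + b • v) →
        (Submodule.Quotient.mk x, Submodule.Quotient.mk y) ∈ LinearMap.range
      ((Submodule.mkQ (LinearMap.range (LinearMap.lsmul (Lam p) N a))).prod
      (Submodule.mkQ (LinearMap.range (LinearMap.lsmul (Lam p) N b)))) := by
      rintro x y ⟨u, v, h⟩
      refine ⟨x - a • u, Prod.ext ?_ ?_⟩
      · refine (Submodule.Quotient.eq _).2 ⟨-u, ?_⟩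
        simp
      · refine (Submodule.Quotient.eq _).2 ⟨v, ?_⟩
        change b • v = _
        rw [sub_right_comm, h, add_sub_cancel_left]
    refine finite_of_smul_eq_zero_of_isRelPrime a (fun x => ?_) fun x => ⟨b, hab, ?_⟩
    · obtain ⟨⟨x, y⟩, rfl⟩ := Submodule.Quotient.mk_surjective _ x
      obtain ⟨x, rfl⟩ := Submodule.Quotient.mk_surjective _ x
      obtain ⟨y, rfl⟩ := Submodule.Quotient.mk_surjective _ y
      rw [← Submodule.Quotient.mk_smul, Submodule.Quotient.mk_eq_zero]
      exact key (a • x) (a • y) ⟨x - y, 0, by rw [smul_sub, smul_zero, add_zero]⟩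
    · obtain ⟨⟨x, y⟩, rfl⟩ := Submodule.Quotient.mk_surjective _ x
      obtain ⟨x, rfl⟩ := Submodule.Quotient.mk_surjective _ x
      obtain ⟨y, rfl⟩ := Submodule.Quotient.mk_surjective _ y
      rw [← Submodule.Quotient.mk_smul, Submodule.Quotient.mk_eq_zero]
      exact key (b • x) (b • y) ⟨0, x - y, by rw [smul_sub, smul_zero, zero_add]⟩

/-- A finitely generated module over the Iwasawa algebra that is killed by a nonzero element is
pseudo-isomorphic to a product of quotients by powers of prime elements. -/
theorem exists_isPseudoIso_pi_prime_pow (a : Lam p) : ∀ (_ : a ≠ 0) (N : Type*) [AddCommGroup N]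
    [Module (Lam p) N] [Module.Finite (Lam p) N] (_ : ∀ x : N, a • x = 0),
    ∃ (ι : Type) (_ : Finite ι) (g : ι → Lam p)
      (φ : N →ₗ[Lam p] ((i : ι) → Lam p ⧸ Ideal.span {g i})),
      (∀ i, ∃ (π : Lam p) (n : ℕ), Prime π ∧ g i = π ^ n) ∧ IsPseudoIso φ := by
  refine UniqueFactorizationMonoid.induction_on_coprime a (fun h => (h rfl).elim)
    (fun {u} hu _ N _ _ _ hN => ?_) (fun {π} n hπ _ N _ _ _ hN => ?_)
    fun {x y} hxy hx hy hxy0 N _ _ _ hN => ?_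
  · have h0 : ∀ x : N, x = 0 := fun x => hu.smul_eq_zero.1 (hN x)
    have : Subsingleton N := ⟨fun x y => (h0 x).trans (h0 y).symm⟩
    refine ⟨Empty, inferInstance, fun i => i.elim, 0, fun i => i.elim, ?_, ?_⟩
    · infer_instance
    · exact Finite.of_subsingleton
  · obtain ⟨k, d, φ, hφ⟩ := exists_isPseudoIso_of_prime_pow hπ n hN
    exact ⟨Fin k, inferInstance, fun i => π ^ d i, φ, fun i => ⟨π, d i, hπ, rfl⟩, hφ⟩
  · obtain ⟨ι₁, _, g₁, φ₁, h₁, hφ₁⟩ := hx (left_ne_zero_of_mul hxy0)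
      (N ⧸ LinearMap.range (LinearMap.lsmul (Lam p) N x)) (fun z => by
        obtain ⟨z, rfl⟩ := Submodule.Quotient.mk_surjective _ z
        exact (Submodule.Quotient.mk_eq_zero _).2 ⟨z, rfl⟩)
    obtain ⟨ι₂, _, g₂, φ₂, h₂, hφ₂⟩ := hy (right_ne_zero_of_mul hxy0)
      (N ⧸ LinearMap.range (LinearMap.lsmul (Lam p) N y)) (fun z => by
        obtain ⟨z, rfl⟩ := Submodule.Quotient.mk_surjective _ z
        exact (Submodule.Quotient.mk_eq_zero _).2 ⟨z, rfl⟩)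
    refine ⟨ι₁ ⊕ ι₂, inferInstance, Sum.elim g₁ g₂,
      (LinearEquiv.sumPiEquivProdPi (Lam p) ι₁ ι₂
        (fun i => Lam p ⧸ Ideal.span {Sum.elim g₁ g₂ i})).symm.toLinearMap ∘ₗ
        ((φ₁.prodMap φ₂) ∘ₗ _), ?_, (isPseudoIso_of_linearEquiv _).comp
        ((hφ₁.prodMap hφ₂).comp (isPseudoIso_prod_quotient hxy hN))⟩
    rintro (i | i)
    · exact h₁ i
    · exact h₂ i

/-- If `p` divides `π ^ n`, then `π` is associated to `p`; otherwise Weierstrass preparation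
applies. The exponent `n = 0` falls under the second alternative, so that all `μ_i` stay positive.
-/
theorem span_prime_pow_eq {π : Lam p} (hπ : Prime π) (n : ℕ) :
    (∃ m, 0 < m ∧ Ideal.span {π ^ n} = Ideal.span {(p : Lam p) ^ m}) ∨
    ∃ F : Polynomial ℤ_[p], F.IsDistinguishedAt (Ideal.span {(p : ℤ_[p])}) ∧
      Ideal.span {π ^ n} = Ideal.span {(F : Lam p)} := by
  by_cases h : (p : Lam p) ∣ π ^ n
  · left
    have hn : n ≠ 0 := by
      rintro rfl
      rw [pow_zero] at h
      exact (prime_natCast_lam p).not_dvd_one h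
    refine ⟨n, Nat.pos_of_ne_zero hn, ?_⟩
    rw [Ideal.span_singleton_eq_span_singleton]
    exact (((prime_natCast_lam p).associated_of_dvd hπ
      ((prime_natCast_lam p).dvd_of_dvd_pow h)).pow_pow).symm
  · exact Or.inr (exists_distinguished_of_not_dvd h)

/-- The structure theorem for finitely generated torsion modules over the Iwasawa algebra. -/
theorem exists_elementary_isPseudoIso (N : Type*) [AddCommGroup N] [Module (Lam p) N]
    [Module.Finite (Lam p) N] {a : Lam p} (ha : a ≠ 0) (hN : ∀ x : N, a • x = 0) :
    ∃ (D : Elementary p) (φ : N →ₗ[Lam p] D.toModule), IsPseudoIso φ := by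
  classical
  obtain ⟨ι, _, g, φ, hg, hφ⟩ := exists_isPseudoIso_pi_prime_pow a ha N hN
  have hg' : ∀ i, (∃ m, 0 < m ∧ Ideal.span {g i} = Ideal.span {(p : Lam p) ^ m}) ∨
      ∃ F : Polynomial ℤ_[p], F.IsDistinguishedAt (Ideal.span {(p : ℤ_[p])}) ∧
      Ideal.span {g i} = Ideal.span {(F : Lam p)} := by
    intro i
    obtain ⟨π, n, hπ, h⟩ := hg i
    rw [h]
    exact span_prime_pow_eq hπ n
  let P : ι → Prop := fun i => ∃ m, 0 < m ∧ Ideal.span {g i} = Ideal.span {(p : Lam p) ^ m}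
  choose m hm hmg using fun i : {i // P i} => i.2
  choose F hF hFg using fun i : {i // ¬ P i} => (hg' i.1).resolve_left i.2
  have := Fintype.ofFinite ι
  let e₁ := Fintype.equivFin {i // P i}
  let e₂ := Fintype.equivFin {i // ¬ P i}
  let D : Elementary p :=
    { r := 0
      s := _
      t := _
      mu := fun i => m (e₁.symm i)
      mu_pos := fun i => hm _
      f := fun j => F (e₂.symm j)
      distinguished := fun j => hF _ }
  let A : ι → Type := fun i => Lam p ⧸ Ideal.span {g i}
  let E₀ : ((i : ι) → A i) ≃ₗ[Lam p] ((i : {i // P i} ⊕ {i // ¬ P i}) → A (Equiv.sumCompl P i)) :=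
    LinearEquiv.piCongrLeft' (Lam p) A (Equiv.sumCompl P).symm
  let E₁ := LinearEquiv.sumPiEquivProdPi (Lam p) {i // P i} {i // ¬ P i}
    (fun i => A (Equiv.sumCompl P i))
  let E₂ : ((i : {i // P i}) → A i.1) ≃ₗ[Lam p]
      ((i : Fin D.s) → Lam p ⧸ Ideal.span {(p : Lam p) ^ D.mu i}) :=
    (LinearEquiv.piCongrLeft' (Lam p) (fun i : {i // P i} => A i.1) e₁).trans
      (LinearEquiv.piCongrRight fun i => Submodule.quotEquivOfEq _ _ (hmg (e₁.symm i)))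
  let E₃ : ((i : {i // ¬ P i}) → A i.1) ≃ₗ[Lam p]
      ((i : Fin D.t) → Lam p ⧸ Ideal.span {(D.f i : Lam p)}) :=
    (LinearEquiv.piCongrLeft' (Lam p) (fun i : {i // ¬ P i} => A i.1) e₂).trans
      (LinearEquiv.piCongrRight fun i => Submodule.quotEquivOfEq _ _ (hFg (e₂.symm i)))
  let E₄ := (E₀.trans E₁).trans (LinearEquiv.prodCongr E₂ E₃)
  let E₅ : (((i : Fin D.s) → Lam p ⧸ Ideal.span {(p : Lam p) ^ D.mu i}) ×
      ((i : Fin D.t) → Lam p ⧸ Ideal.span {(D.f i : Lam p)})) ≃ₗ[Lam p] D.toModule :=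
    { toFun := fun x => ((fun i => i.elim0), x)
      invFun := fun x => x.2
      map_add' := fun x y => Prod.ext (funext fun i => i.elim0) rfl
      map_smul' := fun c x => Prod.ext (funext fun i => i.elim0) rfl
      left_inv := fun x => rfl
      right_inv := fun x => Prod.ext (funext fun i => i.elim0) rfl }
  exact ⟨D, (E₄.trans E₅).toLinearMap ∘ₗ φ, (isPseudoIso_of_linearEquiv _).comp hφ⟩

end Structure

/-! ### Pontryagin duality -/

section Padic

variable {p : ℕ} [Fact p.Prime]

theorem mk_qpModZp_eq_zero_iff {y : ℚ_[p]} :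
    (Submodule.Quotient.mk y : QpModZp p) = 0 ↔ ∃ z : ℤ_[p], (z : ℚ_[p]) = y := by
  rw [Submodule.Quotient.mk_eq_zero]
  rfl

theorem smul_mk_qpModZp (c : ℤ_[p]) (y : ℚ_[p]) :
    c • (Submodule.Quotient.mk y : QpModZp p) = Submodule.Quotient.mk ((c : ℚ_[p]) * y) := by
  rw [← Submodule.Quotient.mk_smul, Algebra.smul_def]
  rfl

variable (p) in
-- Ideals of `ℤ_p` are principal and `ℚ_p / ℤ_p` is divisible: a map on `(m)` sending `m` to the
-- class of `y` extends by `1 ↦ m⁻¹ y`.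
theorem baer_qpModZp : Module.Baer ℤ_[p] (QpModZp p) := by
  intro I g
  obtain ⟨m, rfl⟩ := (IsPrincipalIdealRing.principal I).principal
  obtain rfl | h0 := eq_or_ne m 0
  · refine ⟨0, fun n hn => ?_⟩
    rw [Submodule.span_zero_singleton] at hn
    obtain rfl : n = 0 := hn
    exact (map_zero g).symm
  obtain ⟨y, hy⟩ := Submodule.Quotient.mk_surjective _
    (g ⟨m, Submodule.subset_span (Set.mem_singleton _)⟩)
  have h0' : (m : ℚ_[p]) ≠ 0 := by simpa using h0
  refine ⟨LinearMap.toSpanSingleton ℤ_[p] _ (Submodule.Quotient.mk ((m : ℚ_[p])⁻¹ * y)),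
    fun n hn => ?_⟩
  obtain ⟨n, rfl⟩ := Submodule.mem_span_singleton.1 hn
  have h1 : g ⟨n • m, hn⟩ = n • g ⟨m, Submodule.subset_span (Set.mem_singleton _)⟩ := by
    rw [← map_smul]
    rfl
  rw [h1, ← hy, LinearMap.toSpanSingleton_apply, smul_eq_mul, mul_smul, smul_mk_qpModZp m,
    mul_inv_cancel_left₀ h0']

theorem exists_extend_qpModZp {A B : Type*} [AddCommGroup A] [AddCommGroup B] [Module ℤ_[p] A]
    [Module ℤ_[p] B] (f : A →ₗ[ℤ_[p]] B) (hf : Function.Injective f)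
    (g : A →ₗ[ℤ_[p]] QpModZp p) : ∃ h : B →ₗ[ℤ_[p]] QpModZp p, h ∘ₗ f = g :=
  (baer_qpModZp p).extension_property f hf g

/-- `ℚ_p / ℤ_p` is a cogenerator. -/
theorem exists_linearMap_qpModZp_ne_zero {A : Type*} [AddCommGroup A] [Module ℤ_[p] A] {x : A}
    (hx : x ≠ 0) : ∃ φ : A →ₗ[ℤ_[p]] QpModZp p, φ x ≠ 0 := by
  -- The annihilator of `x ≠ 0` is a proper ideal, hence inside `(p)`, the annihilator of `q`. So `x
  -- ↦ q` is well defined on `ℤ_p x`, and it extends by injectivity.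
  let q : QpModZp p := Submodule.Quotient.mk ((p : ℚ_[p])⁻¹)
  have hp0 : (p : ℚ_[p]) ≠ 0 := by exact_mod_cast (Fact.out : p.Prime).ne_zero
  have hq : q ≠ 0 := by
    intro h
    obtain ⟨z, hz⟩ := mk_qpModZp_eq_zero_iff.1 h
    have : (p : ℤ_[p]) * z = 1 := by
      apply Subtype.ext
      change (p : ℚ_[p]) * z = 1
      rw [hz, mul_inv_cancel₀ hp0]
    exact PadicInt.prime_p.not_isUnit (IsUnit.of_mul_eq_one _ this)
  have hpq : (p : ℤ_[p]) • q = 0 := by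
    rw [smul_mk_qpModZp, mk_qpModZp_eq_zero_iff]
    exact ⟨1, by simp [hp0]⟩
  have hle : Ideal.torsionOf ℤ_[p] A x ≤ LinearMap.ker (LinearMap.toSpanSingleton ℤ_[p] _ q) := by
    intro r hr
    have h1 : r ∈ Ideal.span {(p : ℤ_[p])} := by
      rw [← PadicInt.maximalIdeal_eq_span_p]
      refine IsLocalRing.le_maximalIdeal ?_ hr
      rw [Ne, Ideal.torsionOf_eq_top_iff]
      exact hx
    obtain ⟨s, rfl⟩ := Ideal.mem_span_singleton.1 h1
    rw [LinearMap.mem_ker, LinearMap.toSpanSingleton_apply, mul_comm, mul_smul, hpq, smul_zero]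
  obtain ⟨h, hh⟩ := exists_extend_qpModZp (Submodule.subtype (Submodule.span ℤ_[p] {x}))
    Subtype.val_injective ((Submodule.liftQ _ _ hle) ∘ₗ
      (Ideal.quotTorsionOfEquivSpanSingleton ℤ_[p] A x).symm.toLinearMap)
  refine ⟨h, ?_⟩
  have h1 := LinearMap.congr_fun hh ((Ideal.quotTorsionOfEquivSpanSingleton ℤ_[p] A x)
    (Submodule.Quotient.mk 1))
  have h2 : (((Ideal.quotTorsionOfEquivSpanSingleton ℤ_[p] A x)
    (Submodule.Quotient.mk 1) : Submodule.span ℤ_[p] {x}) : A) = x := by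
    rw [Ideal.quotTorsionOfEquivSpanSingleton_apply_mk]
    simp
  rw [LinearMap.comp_apply, LinearMap.comp_apply, Submodule.subtype_apply, h2,
    LinearEquiv.coe_coe, LinearEquiv.symm_apply_apply, Submodule.liftQ_apply,
    LinearMap.toSpanSingleton_apply, one_smul] at h1
  rw [h1]
  exact hq

theorem exists_linearMap_qpModZp_of_notMem {A : Type*} [AddCommGroup A] [Module ℤ_[p] A]
    (L : Submodule ℤ_[p] A) {x : A} (hx : x ∉ L) :
    ∃ φ : A →ₗ[ℤ_[p]] QpModZp p, (∀ y ∈ L, φ y = 0) ∧ φ x ≠ 0 := by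
  obtain ⟨φ, hφ⟩ := exists_linearMap_qpModZp_ne_zero (p := p) (A := A ⧸ L)
    (x := Submodule.Quotient.mk x) (by rwa [Ne, Submodule.Quotient.mk_eq_zero])
  refine ⟨φ ∘ₗ L.mkQ, fun y hy => ?_, hφ⟩
  rw [LinearMap.comp_apply, Submodule.mkQ_apply, (Submodule.Quotient.mk_eq_zero L).2 hy, map_zero]

/-- The dual of `ℤ_p / (c)` is again cyclic with annihilator `(c)`, generated by `1 ↦ c⁻¹`. -/
theorem card_linearMap_quotient_qpModZp {c : ℤ_[p]} (hc : c ≠ 0) :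
    Nat.card ((ℤ_[p] ⧸ Ideal.span {c}) →ₗ[ℤ_[p]] QpModZp p) =
      Nat.card (ℤ_[p] ⧸ Ideal.span {c}) := by
  have hc' : (c : ℚ_[p]) ≠ 0 := by simpa using hc
  let q : QpModZp p := Submodule.Quotient.mk ((c : ℚ_[p])⁻¹)
  have hq : ∀ z : ℤ_[p], z • q = 0 ↔ z ∈ Ideal.span {c} := by
    intro z
    rw [smul_mk_qpModZp, mk_qpModZp_eq_zero_iff, Ideal.mem_span_singleton]
    constructor
    · rintro ⟨w, hw⟩
      refine ⟨w, Subtype.ext ?_⟩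
      change (z : ℚ_[p]) = c * w
      rw [hw, mul_comm, mul_assoc, inv_mul_cancel₀ hc', mul_one]
    · rintro ⟨w, rfl⟩
      refine ⟨w, ?_⟩
      rw [PadicInt.coe_mul, mul_comm, inv_mul_cancel_left₀ hc']
  let φ₀ : (ℤ_[p] ⧸ Ideal.span {c}) →ₗ[ℤ_[p]] QpModZp p :=
    Submodule.liftQ (Ideal.span {c}) (LinearMap.toSpanSingleton ℤ_[p] _ q)
      fun z hz => (hq z).2 hz
  have hφ₀ : φ₀ (Submodule.Quotient.mk 1) = q := one_smul ℤ_[p] q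
  have hker : LinearMap.ker (LinearMap.toSpanSingleton ℤ_[p] _ φ₀) = Ideal.span {c} := by
    ext z
    rw [LinearMap.mem_ker, LinearMap.toSpanSingleton_apply, ← hq]
    constructor
    · intro h
      have := LinearMap.congr_fun h (Submodule.Quotient.mk 1)
      rwa [LinearMap.smul_apply, hφ₀] at this
    · intro h
      ext
      change z • φ₀ (Submodule.Quotient.mk 1) = 0
      rwa [hφ₀]
  have hsurj : Function.Surjective (LinearMap.toSpanSingleton ℤ_[p] _ φ₀) := by
    intro φ
    obtain ⟨y, hy⟩ := Submodule.Quotient.mk_surjective _ (φ (Submodule.Quotient.mk 1))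
    have h1 : c • φ (Submodule.Quotient.mk 1) = 0 := by
      rw [← map_smul, ← Submodule.Quotient.mk_smul,
        (Submodule.Quotient.mk_eq_zero (Ideal.span {c})).2, map_zero]
      rw [smul_eq_mul, mul_one]
      exact Ideal.mem_span_singleton_self c
    rw [← hy, smul_mk_qpModZp, mk_qpModZp_eq_zero_iff] at h1
    obtain ⟨z, hz⟩ := h1
    refine ⟨z, ?_⟩
    ext
    change z • φ₀ (Submodule.Quotient.mk 1) = φ (Submodule.Quotient.mk 1)
    rw [hφ₀, ← hy, smul_mk_qpModZp, hz, mul_comm, inv_mul_cancel_left₀ hc']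
  exact (Nat.card_congr ((Submodule.quotEquivOfEq _ _ hker.symm).trans
    (LinearMap.quotKerEquivOfSurjective _ hsurj)).toEquiv).symm

/-- A finite `ℤ_p`-module and its Pontryagin dual have the same cardinality. -/
theorem card_linearMap_qpModZp {A : Type*} [AddCommGroup A] [Module ℤ_[p] A] [Finite A] :
    Nat.card (A →ₗ[ℤ_[p]] QpModZp p) = Nat.card A := by
  classical
  have htors : Module.IsTorsion ℤ_[p] A := by
    intro x
    refine ⟨⟨(Nat.card A : ℤ_[p]), mem_nonZeroDivisors_of_ne_zero ?_⟩, ?_⟩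
    · exact_mod_cast Nat.card_pos.ne'
    · change (Nat.card A : ℤ_[p]) • x = 0
      rw [Nat.cast_smul_eq_nsmul, card_nsmul_eq_zero']
  obtain ⟨ι, _, q, hq, e, ⟨ψ⟩⟩ := Module.equiv_directSum_of_isTorsion htors
  let ψ' := ψ.trans (DirectSum.linearEquivFunOnFintype _ ι _)
  rw [Nat.card_congr ψ'.toEquiv, Nat.card_pi,
    Nat.card_congr (LinearEquiv.congrLeft (QpModZp p) ℤ_[p] ψ').toEquiv,
    Nat.card_congr (LinearMap.lsum ℤ_[p] (fun i => ℤ_[p] ⧸ Ideal.span {q i ^ e i})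
      ℤ_[p] (M := QpModZp p)).symm.toEquiv, Nat.card_pi]
  exact Finset.prod_congr rfl fun i _ =>
    card_linearMap_quotient_qpModZp (pow_ne_zero _ (hq i).ne_zero)

end Padic

section Dual

variable {p : ℕ} [Fact p.Prime]

section

variable {A : Type*} [AddCommGroup A] [Module ℤ_[p] A]

theorem dual_apply_zero (φ : Dual p A) : φ 0 = 0 :=
  LinearMap.map_zero (show A →ₗ[ℤ_[p]] QpModZp p from φ)

theorem finite_dual [Finite A] : Finite (Dual p A) := by
  apply Nat.finite_of_card_ne_zero
  rw [Dual, card_linearMap_qpModZp]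
  exact Nat.card_pos.ne'

/-- `A` embeds in its double dual, because functionals separate points. -/
theorem finite_of_finite_dual (h : Finite (Dual p A)) : Finite A := by
  have : Finite (A →ₗ[ℤ_[p]] QpModZp p) := h
  have h2 : Finite ((A →ₗ[ℤ_[p]] QpModZp p) →ₗ[ℤ_[p]] QpModZp p) := by
    apply Nat.finite_of_card_ne_zero
    rw [card_linearMap_qpModZp]
    exact Nat.card_pos.ne'
  refine Finite.of_injective
    (LinearMap.applyₗ : A →ₗ[ℤ_[p]] (A →ₗ[ℤ_[p]] QpModZp p) →ₗ[ℤ_[p]] QpModZp p) ?_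
  rw [injective_iff_map_eq_zero]
  intro x hx
  by_contra h0
  obtain ⟨φ, hφ⟩ := exists_linearMap_qpModZp_ne_zero (p := p) h0
  exact hφ (LinearMap.congr_fun hx φ)

end

variable {A B : Type*} [AddCommGroup A] [Module ℤ_[p] A] [Module (Lam p) A]
  [IsScalarTower ℤ_[p] (Lam p) A] [AddCommGroup B] [Module ℤ_[p] B] [Module (Lam p) B]
  [IsScalarTower ℤ_[p] (Lam p) B]

/-- The Pontryagin dual of a `Λ`-linear map. -/
def dualMap (f : A →ₗ[Lam p] B) : Dual p B →ₗ[Lam p] Dual p A where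
  toFun φ := LinearMap.comp (show B →ₗ[ℤ_[p]] QpModZp p from φ) (f.restrictScalars ℤ_[p])
  map_add' _ _ := rfl
  map_smul' a φ := DFunLike.ext _ _ fun m => congrArg φ (f.map_smul a m).symm

theorem dualMap_apply (f : A →ₗ[Lam p] B) (φ : Dual p B) (x : A) : dualMap f φ x = φ (f x) := rfl

theorem dualMap_surjective {f : A →ₗ[Lam p] B} (hf : Function.Injective f) :
    Function.Surjective (dualMap f) := fun φ =>
  exists_extend_qpModZp (f.restrictScalars ℤ_[p]) hf φ

/-- A functional that kills `ker g` factors through `B / ker g ↪ C` and extends to `C` by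
injectivity of `ℚ_p / ℤ_p`. -/
theorem range_dualMap_eq_ker_dualMap {C : Type*} [AddCommGroup C] [Module ℤ_[p] C]
    [Module (Lam p) C] [IsScalarTower ℤ_[p] (Lam p) C] {f : A →ₗ[Lam p] B} {g : B →ₗ[Lam p] C}
    (h : Function.Exact f g) : LinearMap.ker (dualMap f) = LinearMap.range (dualMap g) := by
  ext φ
  rw [LinearMap.mem_ker]
  constructor
  · intro hφ
    have hφ' : ∀ x, φ (f x) = 0 := fun x => DFunLike.congr_fun hφ x
    let g' : B →ₗ[ℤ_[p]] C := g.restrictScalars ℤ_[p]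
    have hle : LinearMap.ker g' ≤ LinearMap.ker (show B →ₗ[ℤ_[p]] QpModZp p from φ) := by
      intro x hx
      obtain ⟨y, rfl⟩ := (h x).1 hx
      exact hφ' y
    obtain ⟨ψ, hψ⟩ := exists_extend_qpModZp ((LinearMap.ker g').liftQ g' le_rfl)
      (LinearMap.ker_eq_bot.1 (Submodule.ker_liftQ_eq_bot' _ _ rfl))
      ((LinearMap.ker g').liftQ (show B →ₗ[ℤ_[p]] QpModZp p from φ) hle)
    exact ⟨ψ, DFunLike.ext _ _ fun x => LinearMap.congr_fun hψ (Submodule.Quotient.mk x)⟩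
  · rintro ⟨ψ, rfl⟩
    refine DFunLike.ext _ _ fun x => ?_
    rw [dualMap_apply, dualMap_apply, h.apply_apply_eq_zero, dual_apply_zero]
    rfl

theorem dualMap_lsmul (a : Lam p) :
    dualMap (LinearMap.lsmul (Lam p) A a) = LinearMap.lsmul (Lam p) (Dual p A) a := rfl

variable (A) in
-- Dualising `0 → A[a] → A → A` identifies the cokernel of `a` on the dual with the dual of `A[a]`.
-- The next lemma dualises `A → A → A / aA → 0` in the same way.
theorem card_dual_quotient_range_lsmul (a : Lam p)
    [Finite (LinearMap.ker (LinearMap.lsmul (Lam p) A a))] :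
    Nat.card (Dual p A ⧸ LinearMap.range (LinearMap.lsmul (Lam p) (Dual p A) a)) =
      Nat.card (LinearMap.ker (LinearMap.lsmul (Lam p) A a)) := by
  have h := range_dualMap_eq_ker_dualMap
    (LinearMap.exact_subtype_ker_map (LinearMap.lsmul (Lam p) A a))
  rw [dualMap_lsmul] at h
  rw [← h, Nat.card_congr (LinearMap.quotKerEquivOfSurjective _
    (dualMap_surjective (Submodule.subtype_injective _))).toEquiv]
  exact card_linearMap_qpModZp

variable (A) in
theorem card_ker_lsmul_dual (a : Lam p)
    [Finite (A ⧸ LinearMap.range (LinearMap.lsmul (Lam p) A a))] :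
    Nat.card (LinearMap.ker (LinearMap.lsmul (Lam p) (Dual p A) a)) =
      Nat.card (A ⧸ LinearMap.range (LinearMap.lsmul (Lam p) A a)) := by
  have h := range_dualMap_eq_ker_dualMap
    (LinearMap.exact_map_mkQ_range (LinearMap.lsmul (Lam p) A a))
  rw [dualMap_lsmul] at h
  have hinj : Function.Injective
      (dualMap (LinearMap.range (LinearMap.lsmul (Lam p) A a)).mkQ) := by
    intro φ ψ hφψ
    refine DFunLike.ext _ _ fun x => ?_
    obtain ⟨x, rfl⟩ := Submodule.mkQ_surjective _ x
    exact DFunLike.congr_fun hφψ x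
  rw [h, ← Nat.card_congr (LinearEquiv.ofInjective _ hinj).toEquiv]
  exact card_linearMap_qpModZp

end Dual

/-! ### Continuous cohomology of `Γ` -/

section GammaCohomology

variable {p : ℕ} [Fact p.Prime]

theorem isLocallyConstant_padicInt_smul {M : Type*} [AddCommGroup M] [Module ℤ_[p] M] {k : ℕ}
    {y : M} (hy : (p : ℤ_[p]) ^ k • y = 0) :
    IsLocallyConstant fun b : ℤ_[p] => b • y := by
  rw [IsLocallyConstant.iff_exists_open]
  intro b
  have hp : (0 : ℝ) < p := by exact_mod_cast (Fact.out : p.Prime).pos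
  refine ⟨Metric.ball b ((p : ℝ) ^ (-k : ℤ)), Metric.isOpen_ball,
    Metric.mem_ball_self (zpow_pos hp _), fun b' hb' => ?_⟩
  rw [Metric.mem_ball, dist_eq_norm] at hb'
  obtain ⟨c, hc⟩ := Ideal.mem_span_singleton.1
    ((PadicInt.norm_le_pow_iff_mem_span_pow _ _).1 hb'.le)
  rw [← sub_eq_zero, ← sub_smul, hc, mul_comm, mul_smul, hy, smul_zero]

section Torsion

variable {M : Type*} [AddCommGroup M] [Module ℤ_[p] M] [Module (Lam p) M]
  [IsScalarTower ℤ_[p] (Lam p) M]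

/-- A cofinitely generated module is discrete: each element is killed by a power of the maximal
ideal. -/
theorem exists_maximalIdeal_pow_smul_eq_zero (h : CofinitelyGenerated p M) (x : M) :
    ∃ k : ℕ, ∀ r ∈ IsLocalRing.maximalIdeal (Lam p) ^ k, r • x = 0 := by
  have : Module.Finite (Lam p) (Dual p M) := h
  set m := IsLocalRing.maximalIdeal (Lam p)
  -- The functionals vanishing on `𝔪 ^ k x` form an ascending chain in a Noetherian module. Once it
  -- is stationary, `𝔪 ^ n x ⊆ 𝔪 ^ (n + 1) x`, as functionals separate points from submodules;
  -- Nakayama then gives `𝔪 ^ n x = 0`.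
  let F : ℕ →o Submodule (Lam p) (Dual p M) :=
    { toFun := fun k =>
        { carrier := {φ | ∀ r ∈ m ^ k, φ (r • x) = 0}
          add_mem' := fun {φ ψ} hφ hψ r hr => by
            have h1 : (φ + ψ) (r • x) = φ (r • x) + ψ (r • x) := rfl
            rw [h1, hφ r hr, hψ r hr, add_zero]
          zero_mem' := fun r _ => rfl
          smul_mem' := fun a φ hφ r hr => by
            rw [dual_smul_apply, ← mul_smul]
            exact hφ _ (Ideal.mul_mem_left _ _ hr) }
      monotone' := fun i j hij φ hφ r hr => hφ r (Ideal.pow_le_pow_right hij hr) }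
  obtain ⟨n, hn⟩ := monotone_stabilizes_iff_noetherian.2
    (inferInstance : IsNoetherian (Lam p) (Dual p M)) F
  let L : ℕ → Submodule (Lam p) M := fun k =>
    Submodule.map (LinearMap.toSpanSingleton (Lam p) M x) (m ^ k)
  have hL : L n ≤ L (n + 1) := by
    intro y hy
    by_contra hy'
    obtain ⟨φ, hφ, hφy⟩ := exists_linearMap_qpModZp_of_notMem
      ((L (n + 1)).restrictScalars ℤ_[p]) hy'
    have h1 : (show Dual p M from φ) ∈ F (n + 1) := fun r hr => hφ _ ⟨r, hr, rfl⟩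
    rw [← hn (n + 1) (Nat.le_succ n)] at h1
    obtain ⟨r, hr, rfl⟩ := hy
    exact hφy (h1 r hr)
  have hbot : L n = ⊥ := by
    refine Submodule.eq_bot_of_le_smul_of_le_jacobson_bot m _ ?_ ?_
      (IsLocalRing.maximalIdeal_le_jacobson _)
    · exact Submodule.FG.map _ (IsNoetherian.noetherian (m ^ n))
    · refine hL.trans (le_of_eq ?_)
      change Submodule.map _ (m ^ (n + 1)) = m • Submodule.map _ (m ^ n)
      rw [← Submodule.map_smul'', pow_succ', smul_eq_mul]
  refine ⟨n, fun r hr => ?_⟩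
  have h1 : r • x ∈ L n := ⟨r, hr, rfl⟩
  rwa [hbot, Submodule.mem_bot] at h1

theorem exists_pow_smul_eq_zero (h : CofinitelyGenerated p M) (x : M) :
    ∃ k : ℕ, (p : ℤ_[p]) ^ k • x = 0 ∧ (X : Lam p) ^ k • x = 0 := by
  obtain ⟨k, hk⟩ := exists_maximalIdeal_pow_smul_eq_zero h x
  refine ⟨k, ?_, hk _ (Ideal.pow_mem_pow ?_ k)⟩
  · have h1 := hk ((p : Lam p) ^ k) (Ideal.pow_mem_pow (prime_natCast_lam p).not_isUnit k)
    have h2 : ((p : Lam p) ^ k) = algebraMap ℤ_[p] (Lam p) ((p : ℤ_[p]) ^ k) := by simp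
    rwa [h2, algebraMap_smul] at h1
  · exact X_prime.not_isUnit

theorem smul_eq_sum_of_X_pow_smul_eq_zero (k : ℕ) : ∀ (G : Lam p) (x : M),
    (X : Lam p) ^ k • x = 0 →
      G • x = ∑ n ∈ Finset.range k, (coeff n G : ℤ_[p]) • (X : Lam p) ^ n • x := by
  induction k with
  | zero =>
    intro G x hx
    rw [pow_zero, one_smul] at hx
    rw [hx, smul_zero, Finset.range_zero, Finset.sum_empty]
  | succ k ih =>
    intro G x hx
    have hG := eq_X_mul_shift_add_const G
    rw [Finset.sum_range_succ']
    conv_lhs => rw [hG]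
    rw [add_smul, mul_comm, mul_smul, ih _ (X • x) (by rw [← mul_smul, ← pow_succ, hx])]
    congr 1
    · refine Finset.sum_congr rfl fun n _ => ?_
      rw [coeff_mk, ← mul_smul, ← pow_succ]
    · rw [pow_zero, one_smul, ← coeff_zero_eq_constantCoeff_apply]
      exact algebraMap_smul (Lam p) (coeff 0 G) x

/-- Only the first `k` coefficients of `F a` act on `x`, and each matters only modulo `p ^ k`. With
binomial coefficients this gives continuity of the action and of the cocycles built below. -/
theorem isLocallyConstant_smul {k : ℕ} {x : M} (hp : (p : ℤ_[p]) ^ k • x = 0)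
    (hX : (X : Lam p) ^ k • x = 0) (F : ℤ_[p] → Lam p)
    (hF : ∀ n, Continuous fun a => (coeff n (F a) : ℤ_[p])) :
    IsLocallyConstant fun a => F a • x := by
  have h1 : (fun a => F a • x) =
      fun a => ∑ n ∈ Finset.range k, (coeff n (F a) : ℤ_[p]) • (X : Lam p) ^ n • x :=
    funext fun a => smul_eq_sum_of_X_pow_smul_eq_zero k (F a) x hX
  rw [h1]
  let _ : TopologicalSpace M := ⊥
  have : DiscreteTopology M := ⟨rfl⟩
  rw [IsLocallyConstant.iff_continuous]
  refine continuous_finsetSum _ fun n _ => ?_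
  rw [← IsLocallyConstant.iff_continuous]
  refine (isLocallyConstant_padicInt_smul (k := k) (y := (X : Lam p) ^ n • x) ?_).comp_continuous
    (hF n)
  rw [← algebraMap_smul (Lam p), smul_comm, algebraMap_smul, hp, smul_zero]

end Torsion

/-- The power series `((1 + T) ^ a - 1) / T`. -/
def binomialQuot (a : ℤ_[p]) : Lam p := PowerSeries.mk fun n => Ring.choose a (n + 1)

theorem binomialSeries_eq_one_add (a : ℤ_[p]) :
    binomialSeries ℤ_[p] a = 1 + X * binomialQuot a := by
  ext n
  cases n with
  | zero => simp [binomialSeries_coeff]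
  | succ n =>
    rw [map_add, coeff_succ_X_mul, binomialQuot, coeff_mk, binomialSeries_coeff, coeff_one]
    simp

theorem binomialQuot_one : binomialQuot (1 : ℤ_[p]) = 1 := by
  have h := binomialSeries_nat (R := ℤ_[p]) (A := ℤ_[p]) 1
  rw [Nat.cast_one, pow_one, binomialSeries_eq_one_add] at h
  exact mul_left_cancel₀ X_ne_zero ((add_left_cancel h).trans (mul_one _).symm)

/-- The cocycle identity for `γ ^ a ↦ ((1 + T) ^ a - 1) / T`, obtained from `(1 + T) ^ (a + b) = (1
+ T) ^ a (1 + T) ^ b` by cancelling `T`. -/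
theorem binomialQuot_add (a b : ℤ_[p]) :
    binomialQuot (a + b) = binomialQuot a + binomialSeries ℤ_[p] a * binomialQuot b := by
  have h := binomialSeries_add (A := ℤ_[p]) a b
  rw [binomialSeries_eq_one_add, binomialSeries_eq_one_add b] at h
  apply mul_left_cancel₀ (X_ne_zero (R := ℤ_[p]))
  have h1 := binomialSeries_eq_one_add a
  linear_combination h + h1

section Cohomology

variable {Γ : Type*} [Group Γ] [TopologicalSpace Γ] (e : Multiplicative ℤ_[p] ≃ₜ* Γ)

theorem groupElem_apply (g : Γ) :
    groupElem p e g = binomialSeries ℤ_[p] (e.symm g).toAdd := rfl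

variable (M : Type*) [AddCommGroup M] [Module (Lam p) M]

theorem H0_eq_ker : H0 p e M = LinearMap.ker (LinearMap.lsmul (Lam p) M X) := by
  ext m
  rw [LinearMap.mem_ker, LinearMap.lsmul_apply]
  constructor
  · intro h
    have h1 := h (e (Multiplicative.ofAdd 1))
    rwa [groupElem_generator, add_smul, one_smul, add_eq_left] at h1
  · intro h g
    rw [groupElem_apply, binomialSeries_eq_one_add, add_smul, one_smul, mul_comm, mul_smul, h,
      smul_zero, add_zero]

/-- Evaluation of a cocycle at the topological generator, modulo `T M`. -/
def evalGenerator :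
    Z1 p e M →ₗ[Lam p] M ⧸ LinearMap.range (LinearMap.lsmul (Lam p) M X) :=
  Submodule.mkQ _ ∘ₗ LinearMap.proj (e (Multiplicative.ofAdd 1)) ∘ₗ (Z1 p e M).subtype

variable {M} [Module ℤ_[p] M] [IsScalarTower ℤ_[p] (Lam p) M]

theorem isLocallyConstant_smul_toAdd_symm (h : CofinitelyGenerated p M) (m : M)
    (F : ℤ_[p] → Lam p) (hF : ∀ n, Continuous fun a => (coeff n (F a) : ℤ_[p])) :
    IsLocallyConstant fun g : Γ => F (e.symm g).toAdd • m := by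
  obtain ⟨k, hp, hX⟩ := exists_pow_smul_eq_zero h m
  exact (isLocallyConstant_smul hp hX F hF).comp_continuous
    (continuous_toAdd.comp e.symm.continuous)

/-- The cocycle `γ ^ a ↦ (((1 + T) ^ a - 1) / T) • m`, which interpolates `(1 + γ + ⋯ + γ ^ (a - 1))
• m`, takes the value `m` at `γ`. -/
theorem evalGenerator_surjective (h : CofinitelyGenerated p M) :
    Function.Surjective (evalGenerator e M) := by
  intro y
  obtain ⟨m, rfl⟩ := Submodule.Quotient.mk_surjective _ y
  refine ⟨⟨fun g => binomialQuot (e.symm g).toAdd • m,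
    isLocallyConstant_smul_toAdd_symm e h m binomialQuot fun n => ?_, fun g g' => ?_⟩, ?_⟩
  · simp only [binomialQuot, coeff_mk]
    exact PadicInt.continuous_choose (n + 1)
  · change binomialQuot (e.symm (g * g')).toAdd • m = _
    rw [map_mul, toAdd_mul, binomialQuot_add, groupElem_apply, add_smul, mul_smul]
  · change Submodule.Quotient.mk
      (binomialQuot (e.symm (e (Multiplicative.ofAdd 1))).toAdd • m) = _
    rw [ContinuousMulEquiv.symm_apply_apply, toAdd_ofAdd, binomialQuot_one, one_smul]

/-- If `c(γ) = T m`, then `c` and the coboundary of `m` agree at `γ`, hence at all `γ ^ n` with `n ∈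
ℕ`, hence everywhere: both are continuous into discrete `M`, and `ℕ` is dense in `ℤ_p`. -/
theorem ker_evalGenerator (h : CofinitelyGenerated p M) :
    LinearMap.ker (evalGenerator e M) = (B1 p e M).comap (Z1 p e M).subtype := by
  ext ⟨c, hc⟩
  have hev : evalGenerator e M ⟨c, hc⟩ = Submodule.Quotient.mk (c (e (Multiplicative.ofAdd 1))) :=
    rfl
  rw [LinearMap.mem_ker, hev, Submodule.Quotient.mk_eq_zero]
  constructor
  · rintro ⟨m, hm⟩
    rw [LinearMap.lsmul_apply] at hm
    refine ⟨m, fun g => ?_⟩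
    have hnat : ∀ n : ℕ, c (e (Multiplicative.ofAdd (n : ℤ_[p]))) =
        groupElem p e (e (Multiplicative.ofAdd (n : ℤ_[p]))) • m - m := by
      intro n
      induction n with
      | zero =>
        rw [Nat.cast_zero, ofAdd_zero, map_one, map_one, one_smul, sub_self]
        have h1 := hc.2 1 1
        rwa [map_one, one_smul, mul_one, left_eq_add] at h1
      | succ n ih =>
        rw [Nat.cast_succ, ofAdd_add, map_mul, hc.2, ih, map_mul, groupElem_generator, ← hm,
          mul_smul, add_smul, one_smul, smul_add]
        abel
    have hd : IsLocallyConstant fun g : Γ => groupElem p e g • m - m := by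
      refine IsLocallyConstant.sub ?_ (IsLocallyConstant.const m)
      refine isLocallyConstant_smul_toAdd_symm e h m (fun a => binomialSeries ℤ_[p] a) fun n => ?_
      simp only [binomialSeries_coeff, smul_eq_mul, mul_one]
      exact PadicInt.continuous_choose n
    let _ : TopologicalSpace M := ⊥
    have : DiscreteTopology M := ⟨rfl⟩
    have hcont : Continuous fun a : ℤ_[p] => e (Multiplicative.ofAdd a) :=
      e.continuous.comp continuous_ofAdd
    have h2 := PadicInt.denseRange_natCast.equalizer (hc.1.continuous.comp hcont)
      (hd.continuous.comp hcont) (funext hnat)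
    have h3 := congrFun h2 (e.symm g).toAdd
    simpa using h3
  · rintro ⟨m, hm⟩
    refine ⟨m, ?_⟩
    have h1 : c (e (Multiplicative.ofAdd 1)) = _ := hm (e (Multiplicative.ofAdd 1))
    rw [h1, groupElem_generator, add_smul, one_smul, add_sub_cancel_left]
    rfl

/-- `H¹(Γ, M) = M / T M`. -/
def H1Equiv (h : CofinitelyGenerated p M) :
    H1 p e M ≃ₗ[Lam p] M ⧸ LinearMap.range (LinearMap.lsmul (Lam p) M X) :=
  (Submodule.quotEquivOfEq _ _ (ker_evalGenerator e h).symm).trans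
    (LinearMap.quotKerEquivOfSurjective _ (evalGenerator_surjective e h))

end Cohomology

end GammaCohomology

/-! ### The Herbrand quotient under maps with finite kernel and cokernel -/

section Herbrand

variable {N E : Type*} [AddCommGroup N] [AddCommGroup E] {φ : N →+ E} {t : N →+ N} {u : E →+ E}

theorem map_range_eq_map_range (h : ∀ x, φ (t x) = u (φ x)) :
    φ.range.map u = t.range.map φ := by
  ext y
  constructor
  · rintro ⟨_, ⟨x, rfl⟩, rfl⟩
    exact ⟨t x, ⟨x, rfl⟩, h x⟩
  · rintro ⟨_, ⟨x, rfl⟩, rfl⟩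
    exact ⟨φ x, ⟨x, rfl⟩, (h x).symm⟩

theorem relIndex_map_range_mul_index (h : ∀ x, φ (t x) = u (φ x)) :
    (t.range.map φ).relIndex φ.range * φ.range.index = (φ.range.map u).index := by
  rw [map_range_eq_map_range h]
  apply AddSubgroup.relIndex_mul_index
  rintro _ ⟨x, _, rfl⟩
  exact ⟨x, rfl⟩

theorem index_range_eq_relIndex_mul : t.range.index =
    t.range.relIndex φ.ker * (t.range.map φ).relIndex φ.range := by
  rw [← AddSubgroup.index_comap, AddSubgroup.comap_map_eq,
    ← AddSubgroup.relIndex_mul_index (le_sup_left : t.range ≤ t.range ⊔ φ.ker),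
    AddSubgroup.relIndex_sup_left]

/-- The index of `u(E)` divides that of `u(φ(N)) = φ(t(N))`, which is finite through the chain
`φ(t(N)) ≤ φ(N) ≤ E`. Index `0` stands for infinite index. -/
theorem index_range_ne_zero (h : ∀ x, φ (t x) = u (φ x)) (ht : t.range.index ≠ 0)
    (hφ : φ.range.index ≠ 0) : u.range.index ≠ 0 := by
  rw [index_range_eq_relIndex_mul (φ := φ)] at ht
  have h1 : (φ.range.map u).index ≠ 0 := by
    rw [← relIndex_map_range_mul_index h]
    exact mul_ne_zero (right_ne_zero_of_mul ht) hφ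
  intro h0
  have h2 : φ.range.map u ≤ u.range := by
    rintro _ ⟨x, _, rfl⟩
    exact ⟨x, rfl⟩
  have h3 := AddSubgroup.index_dvd_of_le h2
  rw [h0, zero_dvd_iff] at h3
  exact h1 h3

/-- Invariance of the Herbrand quotient under homomorphisms with finite kernel and cokernel, when
the endomorphism of the target is injective. -/
theorem index_range_eq_card_ker_mul (h : ∀ x, φ (t x) = u (φ x)) (hu : Function.Injective u)
    [Finite φ.ker] (hφ : φ.range.index ≠ 0) :
    t.range.index = Nat.card t.ker * u.range.index := by
  -- The index of `u(φ(N))` in `E` is computed through `φ(N)` and through `u(E)`. Injectivity of `u`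
  -- gives `[u(E) : u(φ(N))] = [E : φ(N)]`, which cancels.
  have h1 : (t.range.map φ).relIndex φ.range = u.range.index := by
    apply Nat.eq_of_mul_eq_mul_right (Nat.pos_of_ne_zero hφ)
    rw [relIndex_map_range_mul_index h]
    have h2 : φ.range.map u ≤ u.range := by
      rintro _ ⟨x, _, rfl⟩
      exact ⟨x, rfl⟩
    rw [← AddSubgroup.relIndex_mul_index h2, mul_comm]
    congr 1
    conv_lhs => rw [AddMonoidHom.range_eq_map u]
    rw [AddSubgroup.relIndex_map_map_of_injective _ _ hu, AddSubgroup.relIndex_top_right]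
  -- Hence `ker t ≤ ker φ` and `t(N) ∩ ker φ = t(ker φ)`. On the finite group `ker φ`, the kernel of
  -- `t` has order equal to the index of its image.
  have hker : ∀ x, φ (t x) = 0 ↔ φ x = 0 := fun x => by
    rw [h, map_eq_zero_iff u hu]
  let tK : φ.ker →+ φ.ker := (t.comp φ.ker.subtype).codRestrict φ.ker fun x => (hker x).2 x.2
  have h3 : t.range.relIndex φ.ker = tK.range.index := by
    rw [AddSubgroup.relIndex]
    congr 1
    ext x
    constructor
    · rintro ⟨y, hy⟩
      refine ⟨⟨y, (hker y).1 ?_⟩, Subtype.ext hy⟩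
      rw [hy]
      exact x.2
    · rintro ⟨y, rfl⟩
      exact ⟨y, rfl⟩
  have h4 : Nat.card tK.ker = Nat.card t.ker := by
    refine Nat.card_congr
      { toFun := fun x => ⟨x.1.1, congrArg Subtype.val x.2⟩
        invFun := fun x => ⟨⟨x.1, (hker x.1).1 (by rw [x.2, map_zero])⟩, Subtype.ext x.2⟩
        left_inv := fun x => rfl
        right_inv := fun x => rfl }
  have h5 : tK.range.index = Nat.card tK.ker := by
    have h6 := AddSubgroup.index_mul_card tK.range
    rw [← AddSubgroup.index_mul_card tK.ker, AddSubgroup.index_ker, mul_comm] at h6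
    exact Nat.eq_of_mul_eq_mul_left Nat.card_pos h6
  rw [index_range_eq_relIndex_mul (φ := φ), h1, h3, h5, h4]

end Herbrand

/-! ### Elementary modules: finiteness and multiplication by `T` -/

variable {p : ℕ} [Fact p.Prime]

/-- Two powers of `a` agree on `y` by pigeonhole, and `1 - a ^ (k + 1)` is a unit. -/
theorem exists_pow_smul_eq_zero_of_finite {R F : Type*} [CommRing R] [IsLocalRing R]
    [AddCommGroup F] [Module R F] [Finite F] {a : R} (ha : ¬ IsUnit a) (y : F) :
    ∃ n : ℕ, a ^ n • y = 0 := by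
  obtain ⟨i, j, hij, h⟩ := Finite.exists_ne_map_eq_of_infinite (fun n : ℕ => a ^ n • y)
  wlog hlt : i < j generalizing i j
  · exact this j i hij.symm h.symm (lt_of_le_of_ne (not_lt.1 hlt) hij.symm)
  obtain ⟨k, rfl⟩ := Nat.exists_eq_add_of_lt hlt
  refine ⟨i, ?_⟩
  have hu : IsUnit (1 - a ^ (k + 1)) := by
    apply IsLocalRing.isUnit_one_sub_self_of_mem_nonunits
    intro h1
    exact ha ((isUnit_pow_iff (Nat.succ_ne_zero k)).1 h1)
  rw [← hu.smul_eq_zero, ← mul_smul, sub_mul, one_mul, ← pow_add, sub_smul, sub_eq_zero,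
    show k + 1 + i = i + k + 1 by omega]
  exact h

theorem not_dvd_X_pow (n : ℕ) : ¬ (p : Lam p) ∣ X ^ n := by
  intro h
  have h1 := map_residue_eq_zero_iff.2 h
  rw [map_pow, map_X] at h1
  exact pow_ne_zero n X_ne_zero h1

theorem not_dvd_coe_of_monic {F : Polynomial ℤ_[p]} (hF : F.Monic) :
    ¬ (p : Lam p) ∣ (F : Lam p) := by
  intro h
  have h1 := map_residue_eq_zero_iff.2 h
  have h2 := congrArg (coeff F.natDegree) h1
  rw [coeff_map, Polynomial.coeff_coe, hF.coeff_natDegree, map_one, map_zero] at h2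
  exact one_ne_zero h2

theorem infinite_quotient_pow {n : ℕ} (hn : 0 < n) :
    ¬ Finite (Lam p ⧸ Ideal.span {(p : Lam p) ^ n}) := by
  intro h
  obtain ⟨k, hk⟩ := exists_pow_smul_eq_zero_of_finite (X_prime (R := ℤ_[p])).not_isUnit
    (1 : Lam p ⧸ Ideal.span {(p : Lam p) ^ n})
  have h1 : Ideal.Quotient.mk (Ideal.span {(p : Lam p) ^ n}) (X ^ k * 1) = 0 := hk
  rw [mul_one, Ideal.Quotient.eq_zero_iff_mem, Ideal.mem_span_singleton] at h1
  exact not_dvd_X_pow k ((dvd_pow_self _ hn.ne').trans h1)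

/-- Finiteness gives `F ∣ p ^ k`. As `p ∤ F`, this makes `F` a unit, so its constant term is a unit;
in positive degree `p` would divide that term. -/
theorem natDegree_eq_zero_of_finite_quotient {F : Polynomial ℤ_[p]}
    (hF : F.IsDistinguishedAt (Ideal.span {(p : ℤ_[p])}))
    (h : Finite (Lam p ⧸ Ideal.span {(F : Lam p)})) : F.natDegree = 0 := by
  obtain ⟨k, hk⟩ := exists_pow_smul_eq_zero_of_finite (prime_natCast_lam p).not_isUnit
    (1 : Lam p ⧸ Ideal.span {(F : Lam p)})
  have h1 : Ideal.Quotient.mk (Ideal.span {(F : Lam p)}) ((p : Lam p) ^ k * 1) = 0 := hk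
  rw [mul_one, Ideal.Quotient.eq_zero_iff_mem, Ideal.mem_span_singleton,
    dvd_prime_pow (prime_natCast_lam p)] at h1
  obtain ⟨i, -, hi⟩ := h1
  have hi0 : i = 0 := by
    by_contra h0
    exact not_dvd_coe_of_monic hF.monic ((dvd_pow_self _ h0).trans hi.symm.dvd)
  rw [hi0, pow_zero, associated_one_iff_isUnit, isUnit_iff_constantCoeff,
    Polynomial.constantCoeff_coe] at hi
  by_contra hd
  have h2 := hF.mem (Nat.pos_of_ne_zero hd)
  rw [Ideal.mem_span_singleton] at h2
  exact PadicInt.prime_p.not_isUnit (isUnit_of_dvd_unit h2 hi)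

theorem X_smul_injective_quotient_span {c : Lam p} (hc : constantCoeff c ≠ 0)
    {y : Lam p ⧸ Ideal.span {c}} (hy : (X : Lam p) • y = 0) : y = 0 := by
  obtain ⟨y, rfl⟩ := Ideal.Quotient.mk_surjective y
  have h1 : Ideal.Quotient.mk (Ideal.span {c}) (X * y) = 0 := hy
  rw [Ideal.Quotient.eq_zero_iff_mem, Ideal.mem_span_singleton] at h1 ⊢
  obtain ⟨d, hd⟩ := h1
  have h2 : (X : Lam p) ∣ d :=
    (X_prime.dvd_or_dvd (Dvd.intro y hd)).resolve_left fun h => hc (X_dvd_iff.1 h)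
  obtain ⟨d, rfl⟩ := h2
  exact ⟨d, mul_left_cancel₀ (X_ne_zero (R := ℤ_[p])) (by rw [hd]; ring)⟩

namespace Elementary

variable (D : Elementary p)

/-- If `f_j(0) = 0`, the constant term maps `E` onto the infinite group `ℤ_p` and kills `TE`. -/
theorem constantCoeff_f_ne_zero
    (hD : (LinearMap.lsmul (Lam p) D.toModule X).toAddMonoidHom.range.index ≠ 0) (j : Fin D.t) :
    constantCoeff (D.f j : Lam p) ≠ 0 := by
  intro h0
  let g₀ : (Lam p ⧸ Ideal.span {(D.f j : Lam p)}) →+* ℤ_[p] :=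
    Ideal.Quotient.lift _ constantCoeff fun a ha => by
      obtain ⟨b, rfl⟩ := Ideal.mem_span_singleton.1 ha
      rw [map_mul, h0, zero_mul]
  have hg₀ : ∀ a, g₀ (Ideal.Quotient.mk _ a) = constantCoeff a := fun a => rfl
  let g : D.toModule →+ ℤ_[p] :=
    { toFun := fun x => g₀ (x.2.2 j)
      map_zero' := map_zero g₀
      map_add' := fun x y => map_add g₀ _ _ }
  have hg : Function.Surjective g := fun z =>
    ⟨(0, 0, fun _ => Ideal.Quotient.mk _ (C z)), by
      change g₀ (Ideal.Quotient.mk _ (C z)) = z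
      rw [hg₀, constantCoeff_C]⟩
  have hle : (LinearMap.lsmul (Lam p) D.toModule X).toAddMonoidHom.range ≤ g.ker := by
    rintro _ ⟨x, rfl⟩
    obtain ⟨y, hy⟩ := Ideal.Quotient.mk_surjective (x.2.2 j)
    change g₀ ((X : Lam p) • x.2.2 j) = 0
    rw [← hy]
    change g₀ (Ideal.Quotient.mk _ (X * y)) = 0
    rw [hg₀, map_mul, constantCoeff_X, zero_mul]
  have h1 := AddSubgroup.index_dvd_of_le hle
  rw [AddSubgroup.index_ker, AddMonoidHom.range_eq_top.2 hg, AddSubgroup.card_top,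
    Nat.card_eq_zero_of_infinite, zero_dvd_iff] at h1
  exact hD h1

theorem lsmul_X_injective
    (hD : (LinearMap.lsmul (Lam p) D.toModule X).toAddMonoidHom.range.index ≠ 0) :
    Function.Injective (LinearMap.lsmul (Lam p) D.toModule X) := by
  rw [injective_iff_map_eq_zero]
  intro x hx
  rw [LinearMap.lsmul_apply] at hx
  refine Prod.ext (funext fun i => ?_) (Prod.ext (funext fun i => ?_) (funext fun j => ?_))
  · have h1 : X * x.1 i = 0 := congrFun (congrArg Prod.fst hx) i
    exact (mul_eq_zero.1 h1).resolve_left X_ne_zero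
  · refine X_smul_injective_quotient_span ?_ (congrFun (congrArg (fun z => z.2.1) hx) i)
    rw [map_pow, map_natCast]
    exact pow_ne_zero _ (by exact_mod_cast (Fact.out : p.Prime).ne_zero)
  · exact X_smul_injective_quotient_span (D.constantCoeff_f_ne_zero hD j)
      (congrFun (congrArg (fun z => z.2.2) hx) j)

theorem sum_mu_eq_zero_of_finite (h : Finite D.toModule) : ∑ i, D.mu i = 0 := by
  refine Finset.sum_eq_zero fun i _ => ?_
  have h1 : Function.Surjective fun x : D.toModule => x.2.1 i := fun y =>
    ⟨(0, (fun k => if hk : k = i then hk ▸ y else 0), 0), by simp⟩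
  exact (infinite_quotient_pow (D.mu_pos i) (Finite.of_surjective _ h1)).elim

theorem sum_natDegree_eq_zero_of_finite (h : Finite D.toModule) :
    ∑ j, (D.f j).natDegree = 0 := by
  refine Finset.sum_eq_zero fun i _ => ?_
  have h1 : Function.Surjective fun x : D.toModule => x.2.2 i := fun y =>
    ⟨(0, 0, (fun k => if hk : k = i then hk ▸ y else 0)), by simp⟩
  exact natDegree_eq_zero_of_finite_quotient (D.distinguished i) (Finite.of_surjective _ h1)

theorem f_eq_one (h : ∑ j, (D.f j).natDegree = 0) (j : Fin D.t) : D.f j = 1 :=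
  (D.distinguished j).monic.natDegree_eq_zero.1
    (Finset.sum_eq_zero_iff.1 h j (Finset.mem_univ j))

theorem subsingleton_toModule (hr : IsEmpty (Fin D.r)) (hmu : ∑ i, D.mu i = 0)
    (hf : ∑ j, (D.f j).natDegree = 0) : Subsingleton D.toModule := by
  refine ⟨fun x y => Prod.ext (funext fun i => isEmptyElim i)
    (Prod.ext (funext fun i => ?_) (funext fun j => ?_))⟩
  · exact absurd (Finset.sum_eq_zero_iff.1 hmu i (Finset.mem_univ i)) (D.mu_pos i).ne'
  · have h1 : Subsingleton (Lam p ⧸ Ideal.span {(D.f j : Lam p)}) := by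
      rw [Ideal.Quotient.subsingleton_iff, D.f_eq_one hf, Polynomial.coe_one,
        Ideal.span_singleton_one]
    exact Subsingleton.elim _ _

/-- As the cokernel is finite, some `T ^ n` carries an element with free coordinates `1` into the
range of `φ`, which `a` kills; but `a T ^ n ≠ 0` in `Λ`. -/
theorem isEmpty_of_isTorsion {N : Type*} [AddCommGroup N] [Module (Lam p) N]
    {φ : N →ₗ[Lam p] D.toModule} (hφ : IsPseudoIso φ) {a : Lam p} (ha : a ≠ 0)
    (hN : ∀ x : N, a • x = 0) : IsEmpty (Fin D.r) := by
  refine ⟨fun i => ?_⟩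
  have := hφ.2
  let y : D.toModule := (fun _ => 1, 0, 0)
  obtain ⟨n, hn⟩ := exists_pow_smul_eq_zero_of_finite (X_prime (R := ℤ_[p])).not_isUnit
    (Submodule.Quotient.mk y : D.toModule ⧸ LinearMap.range φ)
  rw [← Submodule.Quotient.mk_smul, Submodule.Quotient.mk_eq_zero] at hn
  obtain ⟨x, hx⟩ := hn
  have h1 : a • (X : Lam p) ^ n • y = 0 := by rw [← hx, ← map_smul, hN, map_zero]
  have h2 : a * (X ^ n * 1) = 0 := congrFun (congrArg Prod.fst h1) i
  rw [mul_one] at h2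
  exact mul_ne_zero ha (pow_ne_zero n X_ne_zero) h2

/-- The product of the `f_j` is monic, so the leading coefficient recovers `p ^ (∑ μ_i)` and the
degree recovers `∑ deg f_j`. -/
theorem charElement_eq_one_iff :
    (p : Polynomial ℤ_[p]) ^ (∑ i, D.mu i) * ∏ j, D.f j = 1 ↔
      ∑ i, D.mu i = 0 ∧ ∑ j, (D.f j).natDegree = 0 := by
  have hmonic : (∏ j, D.f j).Monic :=
    Polynomial.monic_prod_of_monic _ _ fun j _ => (D.distinguished j).monic
  have hC : (p : Polynomial ℤ_[p]) ^ (∑ i, D.mu i) =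
      Polynomial.C ((p : ℤ_[p]) ^ (∑ i, D.mu i)) := by simp
  constructor
  · intro h
    rw [hC] at h
    have hp0 : (p : ℤ_[p]) ^ (∑ i, D.mu i) ≠ 0 :=
      pow_ne_zero _ (by exact_mod_cast (Fact.out : p.Prime).ne_zero)
    constructor
    · have h1 := congrArg Polynomial.leadingCoeff h
      rw [Polynomial.leadingCoeff_mul, Polynomial.leadingCoeff_C, hmonic.leadingCoeff, mul_one,
        Polynomial.leadingCoeff_one] at h1
      by_contra h0
      exact PadicInt.prime_p.not_isUnit ((isUnit_pow_iff h0).1 (h1 ▸ isUnit_one))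
    · have h1 := congrArg Polynomial.natDegree h
      rwa [Polynomial.natDegree_C_mul hp0, Polynomial.natDegree_one,
        Polynomial.natDegree_prod_of_monic _ _ fun j _ => (D.distinguished j).monic] at h1
  · rintro ⟨h1, h2⟩
    rw [h1, pow_zero, one_mul]
    exact Finset.prod_eq_one fun j _ => D.f_eq_one h2 j

end Elementary

theorem subsingleton_of_index_range_X_eq_one {E : Type*} [AddCommGroup E] [Module (Lam p) E]
    [Module.Finite (Lam p) E]
    (h : (LinearMap.lsmul (Lam p) E X).toAddMonoidHom.range.index = 1) : Subsingleton E := by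
  rw [AddSubgroup.index_eq_one] at h
  have h1 : (⊤ : Submodule (Lam p) E) = ⊥ := by
    refine Submodule.eq_bot_of_le_smul_of_le_jacobson_bot (IsLocalRing.maximalIdeal (Lam p)) _
      Module.Finite.fg_top ?_ (IsLocalRing.maximalIdeal_le_jacobson _)
    intro x _
    have h2 : x ∈ (LinearMap.lsmul (Lam p) E X).toAddMonoidHom.range := by
      rw [h]
      trivial
    obtain ⟨y, rfl⟩ := h2
    exact Submodule.smul_mem_smul (X_prime (R := ℤ_[p])).not_isUnit trivial
  exact (Submodule.subsingleton_iff (Lam p)).1 (subsingleton_of_bot_eq_top h1.symm)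

/-- If multiplication by `T` has trivial Herbrand quotient on a module that is pseudo-isomorphic to
an elementary module, then that elementary module is zero. -/
theorem IsPseudoIso.subsingleton_of_card_eq {N : Type*} [AddCommGroup N] [Module (Lam p) N]
    {D : Elementary p} {φ : N →ₗ[Lam p] D.toModule} (hφ : IsPseudoIso φ)
    (h0 : Nat.card (N ⧸ LinearMap.range (LinearMap.lsmul (Lam p) N X)) ≠ 0)
    (h : Nat.card (N ⧸ LinearMap.range (LinearMap.lsmul (Lam p) N X)) =
      Nat.card (LinearMap.ker (LinearMap.lsmul (Lam p) N X))) : Subsingleton D.toModule := by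
  have := hφ.1
  have := hφ.2
  have hcomm : ∀ x, φ.toAddMonoidHom ((LinearMap.lsmul (Lam p) N X).toAddMonoidHom x) =
      (LinearMap.lsmul (Lam p) D.toModule X).toAddMonoidHom (φ.toAddMonoidHom x) :=
    fun x => φ.map_smul X x
  have hidx : (LinearMap.lsmul (Lam p) N X).toAddMonoidHom.range.index =
      Nat.card (N ⧸ LinearMap.range (LinearMap.lsmul (Lam p) N X)) := rfl
  have hfin : φ.toAddMonoidHom.range.index ≠ 0 := by
    change Nat.card (D.toModule ⧸ LinearMap.range φ) ≠ 0
    exact Nat.card_pos.ne'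
  have : Finite φ.toAddMonoidHom.ker := hφ.1
  have hD := index_range_ne_zero hcomm (by rwa [hidx]) hfin
  -- This is `#(N / TN) = #N[T] · #(E / TE)`. The first two orders are equal and nonzero, so `E =
  -- TE`.
  have key := index_range_eq_card_ker_mul hcomm (D.lsmul_X_injective hD) hfin
  have hker : Nat.card (LinearMap.lsmul (Lam p) N X).toAddMonoidHom.ker =
      Nat.card (LinearMap.ker (LinearMap.lsmul (Lam p) N X)) := rfl
  rw [hidx, hker, ← h] at key
  have : Module.Finite (Lam p) D.toModule := inferInstance
  exact subsingleton_of_index_range_X_eq_one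
    ((Nat.mul_eq_left h0).1 key.symm)

/-! ### The Euler characteristic and the equivalences -/

section Main

variable {M : Type*} [AddCommGroup M] [Module ℤ_[p] M] [Module (Lam p) M]
  [IsScalarTower ℤ_[p] (Lam p) M]

theorem exists_smul_dual_eq_zero (hcofg : CofinitelyGenerated p M) (hcotors : Cotorsion p M) :
    ∃ a : Lam p, a ≠ 0 ∧ ∀ φ : Dual p M, a • φ = 0 := by
  have : Module.Finite (Lam p) (Dual p M) := hcofg
  obtain ⟨a, ha, ha0⟩ := Submodule.annihilator_top_inter_nonZeroDivisors hcotors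
  exact ⟨a, nonZeroDivisors.ne_zero ha0, fun φ => Submodule.mem_annihilator.1 ha φ trivial⟩

/-- The structure theorem provides the witness that makes the epsilon-chosen parameters meaningful.
-/
theorem exists_isPseudoIso_elementary (hcofg : CofinitelyGenerated p M)
    (hcotors : Cotorsion p M) :
    ∃ φ : Dual p M →ₗ[Lam p] (elementary p M).toModule, IsPseudoIso φ := by
  have : Module.Finite (Lam p) (Dual p M) := hcofg
  obtain ⟨a, ha, hN⟩ := exists_smul_dual_eq_zero hcofg hcotors
  exact Classical.epsilon_spec (p := fun D : Elementary p =>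
    ∃ φ : Dual p M →ₗ[Lam p] D.toModule, IsPseudoIso φ)
    (exists_elementary_isPseudoIso (Dual p M) ha hN)

theorem finite_of_subsingleton_elementary
    {φ : Dual p M →ₗ[Lam p] (elementary p M).toModule} (hφ : IsPseudoIso φ)
    (h : Subsingleton (elementary p M).toModule) : Finite M :=
  finite_of_finite_dual (p := p) (finite_of_finite_ker φ hφ.1 inferInstance)

theorem eulerChar_eq_one_iff {Γ : Type*} [Group Γ] [TopologicalSpace Γ]
    (e : Multiplicative ℤ_[p] ≃ₜ* Γ) (hcofg : CofinitelyGenerated p M)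
    (hH1 : Finite (H1 p e M)) :
    eulerChar p e M = 1 ↔ Nat.card (LinearMap.ker (LinearMap.lsmul (Lam p) M X)) =
      Nat.card (M ⧸ LinearMap.range (LinearMap.lsmul (Lam p) M X)) := by
  have h0 : (Nat.card (H1 p e M) : ℚ) ≠ 0 := by exact_mod_cast Nat.card_pos.ne'
  rw [eulerChar, div_eq_one_iff_eq h0, Nat.cast_inj, Nat.card_congr (H1Equiv e hcofg).toEquiv,
    H0_eq_ker]

theorem card_ker_eq_card_quotient_range {R A : Type*} [Ring R] [AddCommGroup A] [Module R A]
    [Finite A] (f : A →ₗ[R] A) :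
    Nat.card (LinearMap.ker f) = Nat.card (A ⧸ LinearMap.range f) := by
  have h1 := Submodule.card_eq_card_quotient_mul_card (LinearMap.ker f)
  rw [Submodule.card_eq_card_quotient_mul_card (LinearMap.range f),
    Nat.card_congr f.quotKerEquivRange.toEquiv] at h1
  refine (Nat.eq_of_mul_eq_mul_left (Nat.card_pos (α := LinearMap.range f)) ?_)
  linarith

end Main

end IwasawaEuler

theorem mainTheorem10 (p : ℕ) [Fact p.Prime]
    {Γ : Type*} [Group Γ] [TopologicalSpace Γ] (e : Multiplicative ℤ_[p] ≃ₜ* Γ)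
    {M : Type*} [AddCommGroup M] [Module ℤ_[p] M] [Module (IwasawaEuler.Lam p) M]
    [IsScalarTower ℤ_[p] (IwasawaEuler.Lam p) M]
    (hcofg : IwasawaEuler.CofinitelyGenerated p M) (hcotors : IwasawaEuler.Cotorsion p M)
    (hH0 : Finite (IwasawaEuler.H0 p e M)) (hH1 : Finite (IwasawaEuler.H1 p e M)) :
    [IwasawaEuler.eulerChar p e M = 1,
      IwasawaEuler.charElement p M = 1,
      IwasawaEuler.muInvariant p M = 0 ∧ IwasawaEuler.lambdaInvariant p M = 0,
      Finite M].TFAE := by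
  obtain ⟨φ, hφ⟩ := IwasawaEuler.exists_isPseudoIso_elementary hcofg hcotors
  have := hφ.2
  tfae_have 1 → 4 := by
    intro h
    rw [IwasawaEuler.eulerChar_eq_one_iff e hcofg hH1] at h
    rw [IwasawaEuler.H0_eq_ker] at hH0
    -- Finiteness of `M / TM`, needed to count its dual.
    have := Finite.of_equiv _ (IwasawaEuler.H1Equiv e hcofg).toEquiv
    refine IwasawaEuler.finite_of_subsingleton_elementary hφ (hφ.subsingleton_of_card_eq ?_ ?_)
    · rw [IwasawaEuler.card_dual_quotient_range_lsmul]
      exact Nat.card_pos.ne'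
    · rw [IwasawaEuler.card_dual_quotient_range_lsmul, IwasawaEuler.card_ker_lsmul_dual, h]
  tfae_have 4 → 1 := by
    intro h
    rw [IwasawaEuler.eulerChar_eq_one_iff e hcofg hH1]
    exact IwasawaEuler.card_ker_eq_card_quotient_range _
  tfae_have 2 ↔ 3 := (IwasawaEuler.elementary p M).charElement_eq_one_iff
  tfae_have 3 → 4 := by
    rintro ⟨h1, h2⟩
    -- Neither `μ` nor `λ` sees the free part; it is excluded because the dual is torsion.
    obtain ⟨a, ha, hN⟩ := IwasawaEuler.exists_smul_dual_eq_zero hcofg hcotors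
    exact IwasawaEuler.finite_of_subsingleton_elementary hφ
      ((IwasawaEuler.elementary p M).subsingleton_toModule
        ((IwasawaEuler.elementary p M).isEmpty_of_isTorsion hφ ha hN) h1 h2)
  tfae_have 4 → 3 := by
    intro h
    have := IwasawaEuler.finite_dual (p := p) (A := M)
    have hfin : Finite (IwasawaEuler.elementary p M).toModule := by
      -- The elementary module is an extension of the finite cokernel of `φ` by its range, which is
      -- finite as an image of the finite dual.
      refine IwasawaEuler.finite_of_finite_ker (LinearMap.range φ).mkQ ?_ inferInstance
      rw [Submodule.ker_mkQ]
      exact Finite.of_surjective _ φ.surjective_rangeRestrict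
    exact ⟨(IwasawaEuler.elementary p M).sum_mu_eq_zero_of_finite hfin,
      (IwasawaEuler.elementary p M).sum_natDegree_eq_zero_of_finite hfin⟩
  tfae_finish

end
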